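/- Let $(M^3,g)$ be a connected smooth Riemannian $3$-manifold and let $f:M\to\mathbb{E}^4$ be a smooth isometric immersion into Euclidean $4$-space with second fundamental form $h$. For $x\in M$ and an orthonormal basis $e_1,e_2,e_3$ of $T_xM$ let $\rho(x)=\frac13\sum_{i<j}K(e_i\wedge e_j)$ be the normalized scalar curvature of $g$ ($K$ the sectional curvature) and $\mathcal C_x=\frac13\sum_{i,j=1}^3\|h(e_i,e_j)\|^2$ the Casorati curvature. For a plane $L\subset T_xM$ with orthonormal basis $v_1,v_2$ let $\mathcal C(L)=\frac12\sum_{i,j=1}^2\|h(v_i,v_j)\|^2$, and let $$[\delta_C(2)]_x=\tfrac12\,\mathcal C_x+\tfrac23\,\inf\{\mathcal C(L)\mid L\text{ a plane in }T_xM\}.$$ (One always has $\rho\le\delta_C(2)$.) Suppose that $f$ is Casorati ideal, i.e. $\rho(x)=[\delta_C(2)]_x$ for every $x\in M$, and that $f$ is not totally geodesic, i.e. $h\not\equiv0$. Then $f$ is rigid: for every smooth isometric immersion $f':M\to\mathbb{E}^4$ there is an isometry $\Phi$ of $\mathbb{E}^4$ with $f'=\Phi\circ f$. -/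

import Mathlib

open scoped Manifold ContDiff
open Module Bundle

noncomputable section

namespace Casorati

/-- Euclidean space of dimension `n`. -/
abbrev E (n : ℕ) : Type := EuclideanSpace ℝ (Fin n)

/-- The `i`-th standard basis vector of Euclidean space. -/
def stdVec {n : ℕ} (i : Fin n) : E n := EuclideanSpace.single i 1

/-- The `i`-th partial derivative of a real function on Euclidean space. -/
def partialDeriv {n : ℕ} (i : Fin n) (φ : E n → ℝ) (y : E n) : ℝ := fderiv ℝ φ y (stdVec i)

section Manifold

variable {n : ℕ} {M : Type*} [TopologicalSpace M] [ChartedSpace (E n) M]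

instance (x : M) : FiniteDimensional ℝ (TangentSpace (𝓡 n) x) :=
  inferInstanceAs (FiniteDimensional ℝ (E n))

/-- The coordinates of a tangent vector at `x` with respect to the chart at `x`. -/
def coord (x : M) (u : TangentSpace (𝓡 n) x) : E n :=
  mfderiv (𝓡 n) (𝓡 n) (extChartAt (𝓡 n) x) x u

/-- The `i`-th coordinate vector field of the chart at `x`, at the point with coordinates `y`. -/
def coordField (x : M) (y : E n) (i : Fin n) :
    TangentSpace (𝓡 n) ((extChartAt (𝓡 n) x).symm y) :=
  mfderiv (𝓡 n) (𝓡 n) (extChartAt (𝓡 n) x).symm y (stdVec i)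

/-! ### Intrinsic curvature of a Riemannian manifold -/

section Intrinsic

variable [IsManifold (𝓡 n) ∞ M] [RiemannianBundle (fun x : M ↦ TangentSpace (𝓡 n) x)]

/-- The matrix `g_{ij}` of the metric in the chart at `x`, at the point with coordinates `y`. -/
def metricMatrix (x : M) (y : E n) : Matrix (Fin n) (Fin n) ℝ :=
  Matrix.of fun i j ↦ inner ℝ (coordField x y i) (coordField x y j)

/-- The Christoffel symbol `Γ^k_{ij}` of the Levi-Civita connection in the chart at `x`. -/
def christoffel (x : M) (k i j : Fin n) (y : E n) : ℝ :=
  (1 / 2) * ∑ l, (metricMatrix x y)⁻¹ k l *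
    (partialDeriv i (fun z ↦ metricMatrix x z j l) y
      + partialDeriv j (fun z ↦ metricMatrix x z i l) y
      - partialDeriv l (fun z ↦ metricMatrix x z i j) y)

/-- The component `R^i_{jkl}` at `x`, in the chart at `x`, of the curvature tensor
`R(X, Y) Z = ∇_X ∇_Y Z - ∇_Y ∇_X Z - ∇_{[X, Y]} Z`, that is `R(∂_k, ∂_l) ∂_j = ∑ i, R^i_{jkl} ∂_i`. -/
def curvatureCoeff (x : M) (i j k l : Fin n) : ℝ :=
  let p : E n := extChartAt (𝓡 n) x x
  partialDeriv k (christoffel x i l j) p - partialDeriv l (christoffel x i k j) p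
    + ∑ m, (christoffel x i k m p * christoffel x m l j p
      - christoffel x i l m p * christoffel x m k j p)

/-- The curvature tensor `g(R(u, v) w, z)` on tangent vectors at `x`. -/
def curvatureTensor (x : M) (u v w z : TangentSpace (𝓡 n) x) : ℝ :=
  ∑ i, ∑ j, ∑ k, ∑ l, ∑ m, metricMatrix x (extChartAt (𝓡 n) x x) m i *
    curvatureCoeff x i j k l * coord x z m * coord x w j * coord x u k * coord x v l

/-- The sectional curvature `K(u ∧ v)` of the plane spanned by `u` and `v`. -/
def sectionalCurvature (x : M) (u v : TangentSpace (𝓡 n) x) : ℝ :=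
  curvatureTensor x u v v u / (inner ℝ u u * inner ℝ v v - inner ℝ u v ^ 2)

variable (n) in
/-- The scalar curvature `τ = ∑_{i < j} K(e_i ∧ e_j)`, for an orthonormal basis of the tangent
space (the value does not depend on the basis). -/
def scalarCurvature (x : M) : ℝ :=
  let e := stdOrthonormalBasis ℝ (TangentSpace (𝓡 n) x)
  ∑ i, ∑ j, if i < j then sectionalCurvature x (e i) (e j) else 0

variable (n) in
/-- The normalized scalar curvature `ρ = 2 τ / (n (n - 1))`. -/
def normalizedScalarCurvature (x : M) : ℝ :=
  2 * scalarCurvature n x / ((n : ℝ) * ((n : ℝ) - 1))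

end Intrinsic

/-! ### Second fundamental form and Casorati curvatures of an immersion into Euclidean space -/

section Extrinsic

variable {m : ℕ}

/-- The second fundamental form: the normal component of the second derivative of `f`
read in the chart at `x`. -/
def secondFundamentalForm (f : M → E m) (x : M) (u v : TangentSpace (𝓡 n) x) : E m :=
  let F : E n → E m := f ∘ (extChartAt (𝓡 n) x).symm
  let p : E n := extChartAt (𝓡 n) x x
  (LinearMap.range (fderiv ℝ F p : E n →ₗ[ℝ] E m))ᗮ.starProjection
    (fderiv ℝ (fderiv ℝ F) p (coord x u) (coord x v))

variable (n) in
/-- An immersion is totally geodesic if its second fundamental form vanishes identically. -/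
def IsTotallyGeodesic (f : M → E m) : Prop :=
  ∀ (x : M) (u v : TangentSpace (𝓡 n) x), secondFundamentalForm f x u v = 0

variable [IsManifold (𝓡 n) ∞ M] [RiemannianBundle (fun x : M ↦ TangentSpace (𝓡 n) x)]

variable (n) in
/-- Smooth isometric immersions of a Riemannian `n`-manifold into Euclidean `m`-space. -/
def IsIsometricImmersion (f : M → E m) : Prop :=
  ContMDiff (𝓡 n) (𝓡 m) ∞ f ∧
    ∀ (x : M) (u v : TangentSpace (𝓡 n) x),
      inner ℝ (mfderiv (𝓡 n) (𝓡 m) f x u) (mfderiv (𝓡 n) (𝓡 m) f x v) = inner ℝ u v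

variable (n) in
/-- The Casorati curvature `C = (1 / n) ∑_{i, j} ‖h(e_i, e_j)‖ ^ 2` at `x`, for an orthonormal basis
of the tangent space (the value does not depend on the basis). -/
def casoratiCurvature (f : M → E m) (x : M) : ℝ :=
  let e := stdOrthonormalBasis ℝ (TangentSpace (𝓡 n) x)
  (1 / (n : ℝ)) * ∑ i, ∑ j, ‖secondFundamentalForm f x (e i) (e j)‖ ^ 2

/-- The Casorati curvature `C(L) = (1 / dim L) ∑_{i, j} ‖h(e_i, e_j)‖ ^ 2` of a subspace `L` of the
tangent space, for an orthonormal basis of `L` (the value does not depend on the basis). -/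
def casoratiCurvatureOn (f : M → E m) (x : M) (L : Submodule ℝ (TangentSpace (𝓡 n) x)) : ℝ :=
  let e := stdOrthonormalBasis ℝ L
  (1 / (finrank ℝ L : ℝ)) *
    ∑ i, ∑ j, ‖secondFundamentalForm f x (e i : TangentSpace (𝓡 n) x) (e j)‖ ^ 2

variable (n) in
/-- The normalized `δ`-Casorati curvature
`δ_C(n - 1) = C / 2 + (n + 1) / (2 n) * inf {C(L) | L a hyperplane of the tangent space}`. -/
def deltaCasorati (f : M → E m) (x : M) : ℝ :=
  (1 / 2) * casoratiCurvature n f x + ((n : ℝ) + 1) / (2 * n) *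
    sInf {c : ℝ | ∃ L : Submodule ℝ (TangentSpace (𝓡 n) x),
      finrank ℝ L + 1 = n ∧ c = casoratiCurvatureOn f x L}

variable (n) in
/-- Casorati ideal immersions into Euclidean space: the inequality `ρ ≤ δ_C(n - 1)` is an equality
at every point (the ambient sectional curvature is `0`). -/
def IsCasoratiIdeal (f : M → E m) : Prop :=
  ∀ x : M, normalizedScalarCurvature n x = deltaCasorati n f x

variable (n) in
/-- An isometric immersion is rigid if every isometric immersion of the same Riemannian manifold
into the same Euclidean space differs from it by an isometry of the ambient space. -/
def IsRigid (f : M → E m) : Prop :=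
  ∀ f' : M → E m, IsIsometricImmersion n f' → ∃ Φ : E m ≃ᵢ E m, ∀ x, f' x = Φ (f x)

end Extrinsic

end Manifold

end Casorati

end

open scoped RealInnerProductSpace

noncomputable section

namespace Casorati

/-! ### Framed hypersurfaces of Euclidean 4-space -/

/-! The equality case is first settled pointwise. In an orthonormal frame whose first two vectors
minimise the Casorati curvature of planes, the deficit between the two sides is bounded below by a
positive multiple of a sum of squares. Equality therefore forces the second fundamental form to have
eigenvalues `(a, a, 2a)` for some real `a`, possibly zero (`exists_eq_of_casorati_ideal`).

Where `a ≠ 0` the form has rank three, and the 2×2 minors supplied by the Gauss equation determine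
it up to sign (`eq_or_eq_neg_of_same_curvature`). A second isometric immersion then has the same
first and second fundamental forms after a choice of normal, so the two differ locally by a rigid
motion (`exists_isometry_of_same_forms`).

The remaining difficulty is to exclude flat points, where `a = 0` and the curvature gives no such
control. Let `T` be the unit field of the direction with eigenvalue `2a`. Where `a ≠ 0`, Codazzi
shows that `a` varies only along `T`, that the integral curves of `T` are geodesics and that `T` is
umbilic on its orthogonal complement with factor `k = T(a)/a`. The symmetry of the second derivative
of `T` gives `T(k) = -(k² + 2a²)`. Hence `a⁴ + (ak)² = a⁴ + |∇a|²` is locally constant there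
(`fderiv_energy`). At a flat point `∇a` vanishes too (`fderiv_quarterTrace_eq_zero`), so this
quantity, continuous everywhere, is zero there. A connectedness argument makes flatness an open and
closed condition (`quarterTrace_eq_zero`), so a hypersurface that is not totally geodesic has no
flat point.

Finally, a rigid motion is determined by its effect on any nonflat piece (`isometry_unique`). The
local motions thus agree with one another, and connectedness of `M` yields a single global one. -/

/-- A smooth parametrized hypersurface `F` of Euclidean `4`-space over an open set `Ω`, together with
a smooth unit normal field `N`. -/
structure Framed (Ω : Set (E 3)) (F N : E 3 → E 4) : Prop where
  isOpen : IsOpen Ω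
  contDiffOn : ContDiffOn ℝ ∞ F Ω
  contDiffOn_normal : ContDiffOn ℝ ∞ N Ω
  injective : ∀ y ∈ Ω, Function.Injective (fderiv ℝ F y)
  norm_normal : ∀ y ∈ Ω, ‖N y‖ = 1
  inner_normal : ∀ y ∈ Ω, ∀ u, ⟪fderiv ℝ F y u, N y⟫ = 0

/-- The linear map `(u, t) ↦ dF u + t N`. -/
def frameMap (F N : E 3 → E 4) (y : E 3) : E 3 × ℝ →L[ℝ] E 4 :=
  (fderiv ℝ F y).coprod (ContinuousLinearMap.toSpanSingleton ℝ (N y))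

/-- The inverse of `frameMap` followed by the projection to the tangential part. -/
def tangentPart (F N : E 3 → E 4) (y : E 3) : E 4 →L[ℝ] E 3 :=
  (ContinuousLinearMap.fst ℝ (E 3) ℝ).comp (frameMap F N y).inverse

lemma frameMap_apply (F N : E 3 → E 4) (y : E 3) (u : E 3) (t : ℝ) :
    frameMap F N y (u, t) = fderiv ℝ F y u + t • N y := by
  simp [frameMap]

section

variable {Ω : Set (E 3)} {F N : E 3 → E 4} {y : E 3}

/-- Derivatives of a function that is smooth on an open set are smooth there. -/
lemma contDiffOn_fderiv {V W : Type*} [NormedAddCommGroup V] [NormedSpace ℝ V]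
    [NormedAddCommGroup W] [NormedSpace ℝ W] {s : Set V} {φ : V → W} (hs : IsOpen s)
    (h : ContDiffOn ℝ ∞ φ s) : ContDiffOn ℝ ∞ (fderiv ℝ φ) s :=
  h.fderiv_of_isOpen hs (by simp)

lemma hasFDerivAt_of_contDiffOn {V W : Type*} [NormedAddCommGroup V] [NormedSpace ℝ V]
    [NormedAddCommGroup W] [NormedSpace ℝ W] {s : Set V} {φ : V → W} (hs : IsOpen s)
    (h : ContDiffOn ℝ ∞ φ s) {y : V} (hy : y ∈ s) : HasFDerivAt φ (fderiv ℝ φ y) y :=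
  ((h.contDiffAt (hs.mem_nhds hy)).differentiableAt (by simp)).hasFDerivAt

lemma hasFDerivAt_fderiv_apply {V W : Type*} [NormedAddCommGroup V] [NormedSpace ℝ V]
    [NormedAddCommGroup W] [NormedSpace ℝ W] {s : Set V} {φ : V → W} (hs : IsOpen s)
    (h : ContDiffOn ℝ ∞ φ s) {y : V} (hy : y ∈ s) (u : V) :
    HasFDerivAt (fun z ↦ fderiv ℝ φ z u) ((fderiv ℝ (fderiv ℝ φ) y).flip u) y := by
  have h1 := hasFDerivAt_of_contDiffOn hs (contDiffOn_fderiv hs h) hy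
  have h2 := h1.clm_apply (hasFDerivAt_const u y)
  simpa using h2

lemma fderiv_fderiv_symm {V W : Type*} [NormedAddCommGroup V] [NormedSpace ℝ V]
    [NormedAddCommGroup W] [NormedSpace ℝ W] {s : Set V} {φ : V → W} (hs : IsOpen s)
    (h : ContDiffOn ℝ ∞ φ s) {y : V} (hy : y ∈ s) (u v : V) :
    fderiv ℝ (fderiv ℝ φ) y u v = fderiv ℝ (fderiv ℝ φ) y v u :=
  (h.contDiffAt (hs.mem_nhds hy)).isSymmSndFDerivAt (by
    simp only [minSmoothness_of_isRCLikeNormedField]; 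
    exact WithTop.coe_le_coe.2 (le_top : (2 : ℕ∞) ≤ ⊤)) u v

namespace Framed

lemma frameMap_injective (h : Framed Ω F N) (hy : y ∈ Ω) :
    Function.Injective (frameMap F N y) := by
  rw [injective_iff_map_eq_zero]
  rintro ⟨u, t⟩ hut
  rw [frameMap_apply] at hut
  have h1 := congrArg (fun w ↦ ⟪w, N y⟫) hut
  simp only [inner_add_left, inner_smul_left, h.inner_normal y hy, inner_zero_left,
    real_inner_self_eq_norm_sq, h.norm_normal y hy] at h1
  have ht : t = 0 := by simpa using h1
  subst ht
  have hu : fderiv ℝ F y u = fderiv ℝ F y 0 := by simpa using hut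
  rw [h.injective y hy hu]
  rfl

/-- `frameMap` as an equivalence. -/
lemma exists_equiv (h : Framed Ω F N) (hy : y ∈ Ω) :
    ∃ e : (E 3 × ℝ) ≃L[ℝ] E 4, (e : E 3 × ℝ →L[ℝ] E 4) = frameMap F N y := by
  have hd : finrank ℝ (E 3 × ℝ) = finrank ℝ (E 4) := by simp
  refine ⟨(LinearEquiv.ofInjectiveOfFinrankEq (frameMap F N y).toLinearMap
    (h.frameMap_injective hy) hd).toContinuousLinearEquiv, ?_⟩
  ext <;> rfl

/-- The frame map depends smoothly on the point, and operator inversion is smooth at invertible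
operators. -/
lemma contDiffOn_tangentPart (h : Framed Ω F N) : ContDiffOn ℝ ∞ (tangentPart F N) Ω := by
  have h1 : ContDiffOn ℝ ∞ (frameMap F N) Ω := by
    have := contDiffOn_fderiv h.isOpen h.contDiffOn
    have h2 := h.contDiffOn_normal
    have h3 : frameMap F N = fun y ↦ (fderiv ℝ F y).comp (ContinuousLinearMap.fst ℝ (E 3) ℝ) +
        (ContinuousLinearMap.snd ℝ (E 3) ℝ).smulRight (N y) := by
      funext y; ext <;> simp [frameMap]
    rw [h3]
    have h4 : ContDiff ℝ ∞ (fun w : E 4 ↦ (ContinuousLinearMap.snd ℝ (E 3) ℝ).smulRight w) :=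
      ((ContinuousLinearMap.smulRightL ℝ (E 3 × ℝ) (E 4)
        (ContinuousLinearMap.snd ℝ (E 3) ℝ)).contDiff)
    exact (this.clm_comp contDiffOn_const).add (h4.comp_contDiffOn h2)
  refine contDiffOn_const.clm_comp fun y hy ↦ ?_
  obtain ⟨e, he⟩ := h.exists_equiv hy
  have h2 := contDiffAt_map_inverse (n := ∞) e
  rw [he] at h2
  exact h2.comp_contDiffWithinAt y (h1 y hy)

lemma tangentPart_fderiv (h : Framed Ω F N) (hy : y ∈ Ω) (u : E 3) :
    tangentPart F N y (fderiv ℝ F y u) = u := by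
  obtain ⟨e, he⟩ := h.exists_equiv hy
  have : fderiv ℝ F y u = e (u, 0) := by
    change _ = (e : E 3 × ℝ →L[ℝ] E 4) (u, 0)
    rw [he, frameMap_apply]; simp
  simp [tangentPart, ← he, this]

lemma tangentPart_normal (h : Framed Ω F N) (hy : y ∈ Ω) :
    tangentPart F N y (N y) = 0 := by
  obtain ⟨e, he⟩ := h.exists_equiv hy
  have : N y = e (0, 1) := by
    change _ = (e : E 3 × ℝ →L[ℝ] E 4) (0, 1)
    rw [he, frameMap_apply]; simp
  simp [tangentPart, ← he]
  rw [this]; simp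

lemma decompose (h : Framed Ω F N) (hy : y ∈ Ω) (w : E 4) :
    w = fderiv ℝ F y (tangentPart F N y w) + ⟪w, N y⟫ • N y := by
  obtain ⟨e, he⟩ := h.exists_equiv hy
  obtain ⟨⟨u, t⟩, rfl⟩ := e.surjective w
  have hut : e (u, t) = frameMap F N y (u, t) := by rw [← he]; rfl
  rw [hut, frameMap_apply, map_add, map_smul, h.tangentPart_fderiv hy, h.tangentPart_normal hy]
  simp [inner_add_left, inner_smul_left, h.inner_normal y hy, h.norm_normal y hy]

lemma fderiv_tangentPart (h : Framed Ω F N) (hy : y ∈ Ω) {w : E 4} (hw : ⟪w, N y⟫ = 0) :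
    fderiv ℝ F y (tangentPart F N y w) = w := by
  conv_rhs => rw [h.decompose hy w, hw]
  simp

/-- A vector is determined by its inner products with the frame. -/
lemma ext_inner (h : Framed Ω F N) (hy : y ∈ Ω) {w w' : E 4}
    (h1 : ∀ u, ⟪fderiv ℝ F y u, w⟫ = ⟪fderiv ℝ F y u, w'⟫) (h2 : ⟪w, N y⟫ = ⟪w', N y⟫) :
    w = w' := by
  refine ext_inner_left ℝ fun z ↦ ?_
  rw [h.decompose hy z, inner_add_left, inner_add_left, h1, inner_smul_left, inner_smul_left,
    real_inner_comm w (N y), h2, real_inner_comm w' (N y)]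

lemma hasFDerivAt (h : Framed Ω F N) (hy : y ∈ Ω) : HasFDerivAt F (fderiv ℝ F y) y :=
  hasFDerivAt_of_contDiffOn h.isOpen h.contDiffOn hy

lemma hasFDerivAt_normal (h : Framed Ω F N) (hy : y ∈ Ω) : HasFDerivAt N (fderiv ℝ N y) y :=
  hasFDerivAt_of_contDiffOn h.isOpen h.contDiffOn_normal hy

lemma hasFDerivAt_fderiv (h : Framed Ω F N) (hy : y ∈ Ω) (u : E 3) :
    HasFDerivAt (fun z ↦ fderiv ℝ F z u) ((fderiv ℝ (fderiv ℝ F) y).flip u) y :=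
  hasFDerivAt_fderiv_apply h.isOpen h.contDiffOn hy u

lemma hasFDerivAt_fderiv_normal (h : Framed Ω F N) (hy : y ∈ Ω) (u : E 3) :
    HasFDerivAt (fun z ↦ fderiv ℝ N z u) ((fderiv ℝ (fderiv ℝ N) y).flip u) y :=
  hasFDerivAt_fderiv_apply h.isOpen h.contDiffOn_normal hy u

end Framed

/-- Two functions that agree on an open set have the same derivative there. -/
lemma fderiv_unique_on {V W : Type*} [NormedAddCommGroup V] [NormedSpace ℝ V]
    [NormedAddCommGroup W] [NormedSpace ℝ W] {s : Set V} (hs : IsOpen s) {φ ψ : V → W}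
    (heq : Set.EqOn φ ψ s) {y : V} (hy : y ∈ s) {A B : V →L[ℝ] W}
    (hφ : HasFDerivAt φ A y) (hψ : HasFDerivAt ψ B y) : A = B :=
  hφ.unique (hψ.congr_of_eventuallyEq (heq.eventuallyEq_of_mem (hs.mem_nhds hy)))

/-! ### Weingarten relation and symmetry of the shape operator -/

namespace Framed

lemma inner_fderiv_normal_self (h : Framed Ω F N) (hy : y ∈ Ω) (w : E 3) :
    ⟪fderiv ℝ N y w, N y⟫ = 0 := by
  have h1 := (h.hasFDerivAt_normal hy).inner ℝ (h.hasFDerivAt_normal hy)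
  have h2 := fderiv_unique_on h.isOpen (ψ := fun _ ↦ (1 : ℝ))
    (fun z hz ↦ by simp [h.norm_normal z hz]) hy h1 (hasFDerivAt_const _ _)
  have h3 := DFunLike.congr_fun h2 w
  simpa [real_inner_comm (fderiv ℝ N y w)] using h3

/-- Weingarten's relation. -/
lemma inner_snd_fderiv_normal (h : Framed Ω F N) (hy : y ∈ Ω) (w u : E 3) :
    ⟪fderiv ℝ (fderiv ℝ F) y w u, N y⟫ = -⟪fderiv ℝ F y u, fderiv ℝ N y w⟫ := by
  have h1 := (h.hasFDerivAt_fderiv hy u).inner ℝ (h.hasFDerivAt_normal hy)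
  have h2 := fderiv_unique_on h.isOpen (ψ := fun _ ↦ (0 : ℝ))
    (fun z hz ↦ by simp [h.inner_normal z hz]) hy h1 (hasFDerivAt_const _ _)
  have h3 := DFunLike.congr_fun h2 w
  simp at h3
  linarith

lemma snd_fderiv_symm (h : Framed Ω F N) (hy : y ∈ Ω) (u v : E 3) :
    fderiv ℝ (fderiv ℝ F) y u v = fderiv ℝ (fderiv ℝ F) y v u :=
  fderiv_fderiv_symm h.isOpen h.contDiffOn hy u v

lemma snd_fderiv_normal_symm (h : Framed Ω F N) (hy : y ∈ Ω) (u v : E 3) :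
    fderiv ℝ (fderiv ℝ N) y u v = fderiv ℝ (fderiv ℝ N) y v u :=
  fderiv_fderiv_symm h.isOpen h.contDiffOn_normal hy u v

lemma inner_fderiv_fderiv_normal_symm (h : Framed Ω F N) (hy : y ∈ Ω) (u v : E 3) :
    ⟪fderiv ℝ F y u, fderiv ℝ N y v⟫ = ⟪fderiv ℝ F y v, fderiv ℝ N y u⟫ := by
  have h1 := h.inner_snd_fderiv_normal hy u v
  have h2 := h.inner_snd_fderiv_normal hy v u
  rw [h.snd_fderiv_symm hy] at h1
  linarith

end Framed

end

/-! ### Principal directions -/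

section

variable {Ω : Set (E 3)} {F N : E 3 → E 4} {y : E 3}

/-- The principal curvature `a` of a hypersurface with principal curvatures `(a, a, 2 a)`: a quarter
of the trace of the shape operator. -/
def quarterTrace (F N : E 3 → E 4) (y : E 3) : ℝ :=
  -(1 / 4) * LinearMap.trace ℝ (E 3)
    ((tangentPart F N y).comp (fderiv ℝ N y) : E 3 →L[ℝ] E 3).toLinearMap

/-- The shape operator has principal curvatures `(a, a, 2 a)`, where `T` spans the third principal
direction. -/
def IsPrincipal (F N : E 3 → E 4) (a : ℝ) (T : E 4) (y : E 3) : Prop :=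
  ‖T‖ = 1 ∧ ⟪T, N y⟫ = 0 ∧
    ∀ u, fderiv ℝ N y u = -a • (fderiv ℝ F y u + ⟪fderiv ℝ F y u, T⟫ • T)

/-- The trace of `diag (a, a, 2a)` is `4a`. Expressing `a` by a trace makes it a globally smooth
function, even across its zeros, where `T` is arbitrary and cannot be expected to vary continuously.
-/
lemma IsPrincipal.quarterTrace_eq {a : ℝ} {T : E 4} (hT : IsPrincipal F N a T y)
    (h : Framed Ω F N) (hy : y ∈ Ω) : quarterTrace F N y = a := by
  obtain ⟨h1, h2, h3⟩ := hT
  have h4 : ((tangentPart F N y).comp (fderiv ℝ N y) : E 3 →L[ℝ] E 3).toLinearMap =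
      -a • (LinearMap.id + (((innerSL ℝ T).comp (fderiv ℝ F y) : E 3 →L[ℝ] ℝ).toLinearMap).smulRight
        (tangentPart F N y T)) := by
    ext1 u
    simp [h3, h.tangentPart_fderiv hy, real_inner_comm]
  rw [quarterTrace, h4, map_smul, map_add, LinearMap.trace_id, LinearMap.trace_smulRight]
  simp [h.fderiv_tangentPart hy h2, h1]
  ring

lemma Framed.contDiffOn_quarterTrace (h : Framed Ω F N) : ContDiffOn ℝ ∞ (quarterTrace F N) Ω := by
  let tr : (E 3 →L[ℝ] E 3) →L[ℝ] ℝ := LinearMap.toContinuousLinearMap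
    ((LinearMap.trace ℝ (E 3)).comp (ContinuousLinearMap.coeLM ℝ))
  have h1 : ContDiffOn ℝ ∞ (fun y ↦ (tangentPart F N y).comp (fderiv ℝ N y)) Ω :=
    h.contDiffOn_tangentPart.clm_comp (contDiffOn_fderiv h.isOpen h.contDiffOn_normal)
  exact contDiffOn_const.mul (tr.contDiff.comp_contDiffOn h1)

/-- A linear functional on a space of dimension at least two has a nontrivial kernel. -/
lemma exists_ne_zero_apply_eq_zero (α : E 3 →L[ℝ] ℝ) : ∃ u : E 3, u ≠ 0 ∧ α u = 0 := by
  have h : (α.toLinearMap).ker ≠ ⊥ := LinearMap.ker_ne_bot_of_finrank_lt (by simp)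
  obtain ⟨u, hu, hu0⟩ := Submodule.exists_mem_ne_zero_of_ne_bot h
  exact ⟨u, hu0, hu⟩

lemma exists_ne_zero_apply_eq_zero₂ (α β : E 3 →L[ℝ] ℝ) :
    ∃ u : E 3, u ≠ 0 ∧ α u = 0 ∧ β u = 0 := by
  have h : ((α.prod β).toLinearMap).ker ≠ ⊥ := LinearMap.ker_ne_bot_of_finrank_lt (by simp)
  obtain ⟨u, hu, hu0⟩ := Submodule.exists_mem_ne_zero_of_ne_bot h
  have : (α u, β u) = (0, 0) := hu
  exact ⟨u, hu0, by simpa using this⟩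

lemma Framed.norm_fderiv_pos (h : Framed Ω F N) (hy : y ∈ Ω) {u : E 3} (hu : u ≠ 0) :
    0 < ⟪fderiv ℝ F y u, fderiv ℝ F y u⟫ := by
  rw [real_inner_self_pos]
  intro h0
  exact hu (h.injective y hy (by simpa using h0))

/-- Near a point where `a` does not vanish, the third principal direction can be chosen smoothly. -/
lemma Framed.exists_smooth_principal (h : Framed Ω F N)
    (hid : ∀ y ∈ Ω, ∃ T, IsPrincipal F N (quarterTrace F N y) T y) (hy : y ∈ Ω)
    (ha : quarterTrace F N y ≠ 0) :
    ∃ (Ω' : Set (E 3)) (T : E 3 → E 4), IsOpen Ω' ∧ y ∈ Ω' ∧ Ω' ⊆ Ω ∧ ContDiffOn ℝ ∞ T Ω' ∧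
      (∀ z ∈ Ω', quarterTrace F N z ≠ 0) ∧
      ∀ z ∈ Ω', IsPrincipal F N (quarterTrace F N z) (T z) z := by
  obtain ⟨T₀, hT₀⟩ := hid y hy
  -- The direction `v` is kept constant in coordinates. The vector `P` below equals `⟪dF v, T⟫ • T`,
  -- which is unchanged under `T ↦ -T`. It is therefore smooth without any choice of sign, and
  -- normalising it gives a smooth `T` as long as `s = ⟪dF v, T⟫²` stays positive; at `y` it equals
  -- 1.
  set v := tangentPart F N y T₀ with hv
  have hFv : fderiv ℝ F y v = T₀ := h.fderiv_tangentPart hy hT₀.2.1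
  let P : E 3 → E 4 := fun z ↦ -((quarterTrace F N z)⁻¹ • fderiv ℝ N z v + fderiv ℝ F z v)
  let s : E 3 → ℝ := fun z ↦ ⟪fderiv ℝ F z v, P z⟫
  have hP : ∀ z ∈ Ω, quarterTrace F N z ≠ 0 → ∀ T, IsPrincipal F N (quarterTrace F N z) T z →
      P z = ⟪fderiv ℝ F z v, T⟫ • T := by
    intro z hz haz T hT
    simp only [P, hT.2.2 v, smul_smul]
    rw [mul_neg, inv_mul_cancel₀ haz]
    module
  have hs : ∀ z ∈ Ω, quarterTrace F N z ≠ 0 → ∀ T, IsPrincipal F N (quarterTrace F N z) T z →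
      s z = ⟪fderiv ℝ F z v, T⟫ ^ 2 := by
    intro z hz haz T hT
    simp only [s, hP z hz haz T hT, inner_smul_right]
    ring
  let U : Set (E 3) := Ω ∩ quarterTrace F N ⁻¹' {0}ᶜ
  have hU : IsOpen U :=
    h.contDiffOn_quarterTrace.continuousOn.isOpen_inter_preimage h.isOpen isOpen_compl_singleton
  have hUΩ : U ⊆ Ω := Set.inter_subset_left
  have hdF : ContDiffOn ℝ ∞ (fun z ↦ fderiv ℝ F z v) U :=
    ((contDiffOn_fderiv h.isOpen h.contDiffOn).mono hUΩ).clm_apply contDiffOn_const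
  have hdN : ContDiffOn ℝ ∞ (fun z ↦ fderiv ℝ N z v) U :=
    ((contDiffOn_fderiv h.isOpen h.contDiffOn_normal).mono hUΩ).clm_apply contDiffOn_const
  have hPs : ContDiffOn ℝ ∞ P U :=
    ((((h.contDiffOn_quarterTrace.mono hUΩ).inv fun z hz ↦ hz.2).smul hdN).add hdF).neg
  have hss : ContDiffOn ℝ ∞ s U := hdF.inner ℝ hPs
  let Ω' : Set (E 3) := U ∩ s ⁻¹' Set.Ioi 0
  have hΩ' : IsOpen Ω' := hss.continuousOn.isOpen_inter_preimage hU isOpen_Ioi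
  refine ⟨Ω', fun z ↦ (√(s z))⁻¹ • P z, hΩ', ⟨⟨hy, ha⟩, ?_⟩, fun z hz ↦ hz.1.1, ?_,
    fun z hz ↦ hz.1.2, fun z hz ↦ ?_⟩
  · change 0 < s y
    rw [hs y hy ha T₀ hT₀, hFv]
    simp [hT₀.1]
  · have h1 := hss.mono (Set.inter_subset_left : Ω' ⊆ U)
    have h2 : ∀ z ∈ Ω', s z ≠ 0 := fun z hz ↦ ne_of_gt hz.2
    refine ((h1.sqrt h2).inv fun z hz ↦ ?_).smul (hPs.mono Set.inter_subset_left)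
    exact (Real.sqrt_pos.2 hz.2).ne'
  · obtain ⟨T, hT⟩ := hid z hz.1.1
    have h1 := hP z hz.1.1 hz.1.2 T hT
    have h2 := hs z hz.1.1 hz.1.2 T hT
    have h3 : (0 : ℝ) < s z := hz.2
    set c := ⟪fderiv ℝ F z v, T⟫ with hc
    have hc0 : c ≠ 0 := by rintro h0; simp [h2, h0] at h3
    obtain ⟨ε, hε, hε'⟩ : ∃ ε : ℝ, ε * ε = 1 ∧ (√(s z))⁻¹ • P z = ε • T := by
      refine ⟨(√(s z))⁻¹ * c, ?_, by rw [h1, smul_smul]⟩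
      rw [h2, Real.sqrt_sq_eq_abs]
      have : |c| * |c| = c * c := abs_mul_abs_self c
      have h4 : |c| ≠ 0 := abs_ne_zero.2 hc0
      field_simp
      nlinarith
    simp only [hε']
    obtain ⟨t1, t2, t3⟩ := hT
    refine ⟨?_, by simp [inner_smul_left, t2], fun u ↦ ?_⟩
    · have : |ε| = 1 := by rcases mul_self_eq_one_iff.1 hε with rfl | rfl <;> simp
      simp [norm_smul, t1, this]
    · rw [t3, inner_smul_right, smul_smul]
      rw [show ε * ⟪fderiv ℝ F z u, T⟫ * ε = ⟪fderiv ℝ F z u, T⟫ by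
        linear_combination ⟪fderiv ℝ F z u, T⟫ * hε]

end

/-! ### Structure equations of the principal frame -/

section

variable {Ω : Set (E 3)} {F N : E 3 → E 4} {y : E 3}

/-- A framed hypersurface with principal curvatures `(a, a, 2 a)`, `a` nowhere zero, and smooth
unit field `T` in the third principal direction. -/
structure PrincipalFrame (Ω : Set (E 3)) (F N : E 3 → E 4) (a : E 3 → ℝ) (T : E 3 → E 4) : Prop
    extends Framed Ω F N where
  smooth_a : ContDiffOn ℝ ∞ a Ω
  smooth_T : ContDiffOn ℝ ∞ T Ω
  ne_zero : ∀ y ∈ Ω, a y ≠ 0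
  principal : ∀ y ∈ Ω, IsPrincipal F N (a y) (T y) y

namespace PrincipalFrame

variable {a : E 3 → ℝ} {T : E 3 → E 4}

lemma hasFDerivAt_a (h : PrincipalFrame Ω F N a T) (hy : y ∈ Ω) :
    HasFDerivAt a (fderiv ℝ a y) y := hasFDerivAt_of_contDiffOn h.isOpen h.smooth_a hy

lemma hasFDerivAt_T (h : PrincipalFrame Ω F N a T) (hy : y ∈ Ω) :
    HasFDerivAt T (fderiv ℝ T y) y := hasFDerivAt_of_contDiffOn h.isOpen h.smooth_T hy

lemma inner_T_self (h : PrincipalFrame Ω F N a T) (hy : y ∈ Ω) : ⟪T y, T y⟫ = 1 := by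
  simp [(h.principal y hy).1]

lemma inner_T_N (h : PrincipalFrame Ω F N a T) (hy : y ∈ Ω) : ⟪T y, N y⟫ = 0 :=
  (h.principal y hy).2.1

lemma fderiv_N (h : PrincipalFrame Ω F N a T) (hy : y ∈ Ω) (u : E 3) :
    fderiv ℝ N y u = -a y • (fderiv ℝ F y u + ⟪fderiv ℝ F y u, T y⟫ • T y) :=
  (h.principal y hy).2.2 u

lemma exists_dir (h : PrincipalFrame Ω F N a T) (hy : y ∈ Ω) : ∃ e, fderiv ℝ F y e = T y :=
  ⟨_, h.fderiv_tangentPart hy (h.inner_T_N hy)⟩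

lemma inner_fderiv_T_T (h : PrincipalFrame Ω F N a T) (hy : y ∈ Ω) (w : E 3) :
    ⟪fderiv ℝ T y w, T y⟫ = 0 := by
  have h1 := (h.hasFDerivAt_T hy).inner ℝ (h.hasFDerivAt_T hy)
  have h2 := fderiv_unique_on h.isOpen (ψ := fun _ ↦ (1 : ℝ))
    (fun z hz ↦ h.inner_T_self hz) hy h1 (hasFDerivAt_const _ _)
  have h3 := DFunLike.congr_fun h2 w
  simpa [real_inner_comm (fderiv ℝ T y w)] using h3

lemma inner_fderiv_T_N (h : PrincipalFrame Ω F N a T) (hy : y ∈ Ω) (w : E 3) :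
    ⟪fderiv ℝ T y w, N y⟫ = 2 * a y * ⟪fderiv ℝ F y w, T y⟫ := by
  have h1 := (h.hasFDerivAt_T hy).inner ℝ (h.hasFDerivAt_normal hy)
  have h2 := fderiv_unique_on h.isOpen (ψ := fun _ ↦ (0 : ℝ))
    (fun z hz ↦ h.inner_T_N hz) hy h1 (hasFDerivAt_const _ _)
  have h3 := DFunLike.congr_fun h2 w
  simp [h.fderiv_N hy, inner_add_right, inner_smul_right, (h.principal y hy).1,
    real_inner_comm (fderiv ℝ F y w)] at h3
  linarith

lemma hasFDerivAt_theta (h : PrincipalFrame Ω F N a T) (hy : y ∈ Ω) (v : E 3) :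
    HasFDerivAt (fun z ↦ ⟪fderiv ℝ F z v, T z⟫) ((innerSL ℝ (T y)).comp
      ((fderiv ℝ (fderiv ℝ F) y).flip v) + (innerSL ℝ (fderiv ℝ F y v)).comp (fderiv ℝ T y)) y := by
  refine ((h.hasFDerivAt_fderiv hy v).inner ℝ (h.hasFDerivAt_T hy)).congr_fderiv ?_
  ext1 w
  simp [real_inner_comm (T y), add_comm]

/-- The Codazzi equation. -/
lemma codazzi (h : PrincipalFrame Ω F N a T) (hy : y ∈ Ω) (u v : E 3) :
    fderiv ℝ a y u • (fderiv ℝ F y v + ⟪fderiv ℝ F y v, T y⟫ • T y) +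
      a y • (⟪fderiv ℝ F y v, fderiv ℝ T y u⟫ • T y + ⟪fderiv ℝ F y v, T y⟫ • fderiv ℝ T y u) =
    fderiv ℝ a y v • (fderiv ℝ F y u + ⟪fderiv ℝ F y u, T y⟫ • T y) +
      a y • (⟪fderiv ℝ F y u, fderiv ℝ T y v⟫ • T y + ⟪fderiv ℝ F y u, T y⟫ • fderiv ℝ T y v) := by
  have key : ∀ u v, fderiv ℝ (fderiv ℝ N) y u v =
      -(fderiv ℝ a y u • (fderiv ℝ F y v + ⟪fderiv ℝ F y v, T y⟫ • T y) +
      a y • (fderiv ℝ (fderiv ℝ F) y u v +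
        ((⟪T y, fderiv ℝ (fderiv ℝ F) y u v⟫ + ⟪fderiv ℝ F y v, fderiv ℝ T y u⟫) • T y +
        ⟪fderiv ℝ F y v, T y⟫ • fderiv ℝ T y u))) := by
    intro u v
    have h1 := ((h.hasFDerivAt_a hy).neg).smul ((h.hasFDerivAt_fderiv hy v).add
      ((h.hasFDerivAt_theta hy v).smul (h.hasFDerivAt_T hy)))
    have h2 := fderiv_unique_on h.isOpen (fun z hz ↦ h.fderiv_N hz v) hy
      (h.hasFDerivAt_fderiv_normal hy v) h1
    have h3 := DFunLike.congr_fun h2 u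
    simp at h3
    rw [h3]
    module
  have h1 := key u v
  have h2 := key v u
  rw [h.snd_fderiv_normal_symm hy, h2, h.snd_fderiv_symm hy] at h1
  linear_combination (norm := module) (1 : ℝ) • h1

/-- The logarithmic derivative of `a` in the direction of `T`. -/
def logDeriv (F N : E 3 → E 4) (a : E 3 → ℝ) (T : E 3 → E 4) (z : E 3) : ℝ :=
  (a z)⁻¹ * fderiv ℝ a z (tangentPart F N z (T z))

lemma contDiffOn_logDeriv (h : PrincipalFrame Ω F N a T) :
    ContDiffOn ℝ ∞ (logDeriv F N a T) Ω :=
  (h.smooth_a.inv h.ne_zero).mul ((contDiffOn_fderiv h.isOpen h.smooth_a).clm_apply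
    (h.contDiffOn_tangentPart.clm_apply h.smooth_T))

/-- Dimension three leaves a nonzero direction `v` orthogonal to both `T` and `u`. Pairing the
Codazzi equation for `u, v` with `dF v` leaves only `da(u) |dF v|²`. -/
lemma fderiv_a_eq_zero (h : PrincipalFrame Ω F N a T) (hy : y ∈ Ω) {u : E 3}
    (hu : ⟪fderiv ℝ F y u, T y⟫ = 0) : fderiv ℝ a y u = 0 := by
  obtain ⟨v, hv0, hv1, hv2⟩ := exists_ne_zero_apply_eq_zero₂
    ((innerSL ℝ (T y)).comp (fderiv ℝ F y)) ((innerSL ℝ (fderiv ℝ F y u)).comp (fderiv ℝ F y))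
  simp only [ContinuousLinearMap.comp_apply, innerSL_apply_apply] at hv1 hv2
  rw [real_inner_comm] at hv1
  have h1 := congrArg (fun w ↦ ⟪w, fderiv ℝ F y v⟫) (h.codazzi hy u v)
  simp only [hu, hv1, zero_smul, add_zero, inner_add_left, inner_smul_left, hv2,
    real_inner_comm (fderiv ℝ F y v) (T y)] at h1
  have h2 := h.norm_fderiv_pos hy hv0
  simp at h1
  rcases h1 with h1 | h1
  · exact h1
  · simp [h1] at h2

lemma inner_T_fderiv_self (h : PrincipalFrame Ω F N a T) (hy : y ∈ Ω) {e : E 3}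
    (he : fderiv ℝ F y e = T y) (u : E 3) :
    ⟪fderiv ℝ F y (u - ⟪fderiv ℝ F y u, T y⟫ • e), T y⟫ = 0 := by
  simp [inner_sub_left, inner_smul_left, he, (h.principal y hy).1]

lemma fderiv_a (h : PrincipalFrame Ω F N a T) (hy : y ∈ Ω) (u : E 3) :
    fderiv ℝ a y u = a y * logDeriv F N a T y * ⟪fderiv ℝ F y u, T y⟫ := by
  have he := h.fderiv_tangentPart hy (h.inner_T_N hy)
  have h1 := h.fderiv_a_eq_zero hy (h.inner_T_fderiv_self hy he u)
  have h2 := h.ne_zero y hy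
  rw [map_sub, map_smul, sub_eq_zero, smul_eq_mul] at h1
  rw [h1, logDeriv]
  field_simp

/-- Codazzi for `u` and the direction of `T` expresses `a • dT(u)` through `dF u` and `T`. Since
`dT(u)` is orthogonal to `T`, the coefficient of `T` must vanish, which gives both claims. -/
lemma fderiv_T_of_perp (h : PrincipalFrame Ω F N a T) (hy : y ∈ Ω) {e : E 3}
    (he : fderiv ℝ F y e = T y) {u : E 3} (hu : ⟪fderiv ℝ F y u, T y⟫ = 0) :
    ⟪fderiv ℝ F y u, fderiv ℝ T y e⟫ = 0 ∧
      fderiv ℝ T y u = logDeriv F N a T y • fderiv ℝ F y u := by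
  have h0 := h.ne_zero y hy
  have h1 := h.codazzi hy u e
  have hu' : ⟪T y, fderiv ℝ T y u⟫ = 0 := by rw [real_inner_comm, h.inner_fderiv_T_T hy]
  have hT1 := h.inner_T_self hy
  simp only [h.fderiv_a hy, hu, he, hT1, mul_zero, zero_smul, zero_add, add_zero, one_smul,
    mul_one, hu'] at h1
  have h2 := congrArg (fun w ↦ ⟪w, T y⟫) h1
  simp only [inner_add_left, inner_smul_left, h.inner_fderiv_T_T hy, hu, hT1] at h2
  have h3 : ⟪fderiv ℝ F y u, fderiv ℝ T y e⟫ = 0 := by simpa [h0] using h2.symm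
  refine ⟨h3, ?_⟩
  rw [h3] at h1
  have h4 : a y • fderiv ℝ T y u = a y • (logDeriv F N a T y • fderiv ℝ F y u) := by
    rw [h1]; module
  exact smul_right_injective _ h0 h4

/-- Geometrically, the integral curves of `T` are geodesics of the hypersurface with normal
curvature `2a`, and `T` is umbilic on its orthogonal complement with factor `logDeriv`. -/
lemma fderiv_T (h : PrincipalFrame Ω F N a T) (hy : y ∈ Ω) (u : E 3) :
    fderiv ℝ T y u = logDeriv F N a T y •
      (fderiv ℝ F y u - ⟪fderiv ℝ F y u, T y⟫ • T y) + (2 * a y * ⟪fderiv ℝ F y u, T y⟫) • N y := by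
  obtain ⟨e, he⟩ := h.exists_dir hy
  have hTe : fderiv ℝ T y e = (2 * a y) • N y := by
    refine h.ext_inner hy (fun w ↦ ?_) ?_
    · have h1 := (h.fderiv_T_of_perp hy he (h.inner_T_fderiv_self hy he w)).1
      rw [map_sub, map_smul, he, inner_sub_left, inner_smul_left, real_inner_comm _ (T y),
        h.inner_fderiv_T_T hy] at h1
      simp [inner_smul_right, h.inner_normal y hy]
      simpa using h1
    · rw [h.inner_fderiv_T_N hy, he, h.inner_T_self hy]
      simp [inner_smul_left, h.norm_normal y hy]
  have h2 := (h.fderiv_T_of_perp hy he (h.inner_T_fderiv_self hy he u)).2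
  rw [map_sub, map_smul, map_sub, map_smul, hTe, he, sub_eq_iff_eq_add] at h2
  rw [h2]
  module

/-- The symmetry of the second derivative of `T`, expressed through the structure equations. -/
lemma codazzi_T (h : PrincipalFrame Ω F N a T) (hy : y ∈ Ω) (w u : E 3) :
    fderiv ℝ (logDeriv F N a T) y w • (fderiv ℝ F y u - ⟪fderiv ℝ F y u, T y⟫ • T y)
      - (logDeriv F N a T y * ⟪fderiv ℝ F y u, T y⟫) • fderiv ℝ T y w
      + (2 * fderiv ℝ a y w * ⟪fderiv ℝ F y u, T y⟫) • N y
      + (2 * a y * ⟪fderiv ℝ F y u, T y⟫) • fderiv ℝ N y w =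
    fderiv ℝ (logDeriv F N a T) y u • (fderiv ℝ F y w - ⟪fderiv ℝ F y w, T y⟫ • T y)
      - (logDeriv F N a T y * ⟪fderiv ℝ F y w, T y⟫) • fderiv ℝ T y u
      + (2 * fderiv ℝ a y u * ⟪fderiv ℝ F y w, T y⟫) • N y
      + (2 * a y * ⟪fderiv ℝ F y w, T y⟫) • fderiv ℝ N y u := by
  have hk := hasFDerivAt_of_contDiffOn h.isOpen h.contDiffOn_logDeriv hy
  have key : ∀ w u, fderiv ℝ (fderiv ℝ T) y w u =
      fderiv ℝ (logDeriv F N a T) y w • (fderiv ℝ F y u - ⟪fderiv ℝ F y u, T y⟫ • T y)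
      + logDeriv F N a T y • (fderiv ℝ (fderiv ℝ F) y w u
        - (⟪T y, fderiv ℝ (fderiv ℝ F) y w u⟫ + ⟪fderiv ℝ F y u, fderiv ℝ T y w⟫) • T y
        - ⟪fderiv ℝ F y u, T y⟫ • fderiv ℝ T y w)
      + (2 * fderiv ℝ a y w * ⟪fderiv ℝ F y u, T y⟫ + 2 * a y *
        (⟪T y, fderiv ℝ (fderiv ℝ F) y w u⟫ + ⟪fderiv ℝ F y u, fderiv ℝ T y w⟫)) • N y
      + (2 * a y * ⟪fderiv ℝ F y u, T y⟫) • fderiv ℝ N y w := by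
    intro w u
    have h1 := (hk.smul ((h.hasFDerivAt_fderiv hy u).sub
      ((h.hasFDerivAt_theta hy u).smul (h.hasFDerivAt_T hy)))).add
      ((((h.hasFDerivAt_a hy).const_mul 2).mul (h.hasFDerivAt_theta hy u)).smul
        (h.hasFDerivAt_normal hy))
    have h2 := fderiv_unique_on h.isOpen (fun z hz ↦ h.fderiv_T hz u) hy
      (hasFDerivAt_fderiv_apply h.isOpen h.smooth_T hy u) h1
    have h3 := DFunLike.congr_fun h2 w
    simp at h3
    rw [h3]
    module
  -- This says that the 1-form `⟪dF ·, T⟫` is closed, so all terms containing its derivative cancel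
  -- when the two orders of differentiation are compared.
  have hsymm : ⟪fderiv ℝ F y w, fderiv ℝ T y u⟫ = ⟪fderiv ℝ F y u, fderiv ℝ T y w⟫ := by
    rw [h.fderiv_T hy, h.fderiv_T hy]
    simp only [inner_add_right, inner_smul_right, inner_sub_right, h.inner_normal y hy,
      real_inner_comm (fderiv ℝ F y u) (fderiv ℝ F y w)]
    ring
  have h1 := key w u
  have h2 := key u w
  rw [fderiv_fderiv_symm h.isOpen h.smooth_T hy, h2, h.snd_fderiv_symm hy, hsymm] at h1
  linear_combination (norm := module) (-1 : ℝ) • h1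

lemma fderiv_logDeriv_eq_zero (h : PrincipalFrame Ω F N a T) (hy : y ∈ Ω) {u : E 3}
    (hu : ⟪fderiv ℝ F y u, T y⟫ = 0) : fderiv ℝ (logDeriv F N a T) y u = 0 := by
  obtain ⟨v, hv0, hv1, hv2⟩ := exists_ne_zero_apply_eq_zero₂
    ((innerSL ℝ (T y)).comp (fderiv ℝ F y)) ((innerSL ℝ (fderiv ℝ F y u)).comp (fderiv ℝ F y))
  simp only [ContinuousLinearMap.comp_apply, innerSL_apply_apply] at hv1 hv2
  rw [real_inner_comm] at hv1
  have h1 := congrArg (fun w ↦ ⟪w, fderiv ℝ F y v⟫) (h.codazzi_T hy u v)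
  simp only [hu, hv1, zero_smul, sub_zero, mul_zero, add_zero, inner_smul_left, hv2] at h1
  have h2 := h.norm_fderiv_pos hy hv0
  simp at h1
  rcases h1 with h1 | h1
  · exact h1
  · simp [h1] at h2

/-- This is a Riccati equation along `T`: the term `2a²` is the sectional curvature of a plane
containing `T`, the product of the principal curvatures `a` and `2a`. It is read off from
`codazzi_T` for the direction of `T` and one orthogonal direction. -/
lemma fderiv_logDeriv (h : PrincipalFrame Ω F N a T) (hy : y ∈ Ω) (u : E 3) :
    fderiv ℝ (logDeriv F N a T) y u =
      -(logDeriv F N a T y ^ 2 + 2 * a y ^ 2) * ⟪fderiv ℝ F y u, T y⟫ := by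
  obtain ⟨e, he⟩ := h.exists_dir hy
  have h1 := h.fderiv_logDeriv_eq_zero hy (h.inner_T_fderiv_self hy he u)
  rw [map_sub, map_smul, sub_eq_zero, smul_eq_mul] at h1
  rw [h1, mul_comm]
  congr 1
  obtain ⟨v, hv0, hv⟩ := exists_ne_zero_apply_eq_zero ((innerSL ℝ (T y)).comp (fderiv ℝ F y))
  simp only [ContinuousLinearMap.comp_apply, innerSL_apply_apply] at hv
  rw [real_inner_comm] at hv
  have h2 := h.codazzi_T hy e v
  simp only [hv, he, h.fderiv_N hy, h.fderiv_a hy, h.fderiv_T hy, h.inner_T_self hy] at h2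
  have h3 : (fderiv ℝ (logDeriv F N a T) y e + (logDeriv F N a T y ^ 2 + 2 * a y ^ 2)) •
      fderiv ℝ F y v = 0 := by
    rw [← sub_eq_zero] at h2
    rw [← h2]
    module
  have h4 : fderiv ℝ F y v ≠ 0 := fun h0 ↦ by simpa [h0] using h.norm_fderiv_pos hy hv0
  have h5 := (smul_eq_zero.1 h3).resolve_right h4
  linarith

/-- The first integral of the structure equations. -/
lemma fderiv_energy (h : PrincipalFrame Ω F N a T) (hy : y ∈ Ω) :
    HasFDerivAt (fun z ↦ a z ^ 4 + (a z * logDeriv F N a T z) ^ 2) (0 : E 3 →L[ℝ] ℝ) y := by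
  have hk := hasFDerivAt_of_contDiffOn h.isOpen h.contDiffOn_logDeriv hy
  have h1 := ((h.hasFDerivAt_a hy).pow 4).add (((h.hasFDerivAt_a hy).mul hk).pow 2)
  -- With `k` for `logDeriv`, `T(a) = ak` and `T(k) = -(k² + 2a²)`, the derivative along `T` is
  -- `4a⁴k + 2ak(ak² - a(k² + 2a²)) = 0`.
  refine h1.congr_fderiv ?_
  ext1 u
  simp [h.fderiv_a hy, h.fderiv_logDeriv hy]
  ring

end PrincipalFrame

end

/-! ### Propagation of flatness -/

section

variable {Ω : Set (E 3)} {F N : E 3 → E 4} {y : E 3}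

lemma Framed.mono (h : Framed Ω F N) {Ω' : Set (E 3)} (ho : IsOpen Ω') (hs : Ω' ⊆ Ω) :
    Framed Ω' F N where
  isOpen := ho
  contDiffOn := h.contDiffOn.mono hs
  contDiffOn_normal := h.contDiffOn_normal.mono hs
  injective y hy := h.injective y (hs hy)
  norm_normal y hy := h.norm_normal y (hs hy)
  inner_normal y hy := h.inner_normal y (hs hy)

/-- The hypersurface has principal curvatures of the form `(a, a, 2 a)` at every point. -/
def IsIdealOn (Ω : Set (E 3)) (F N : E 3 → E 4) : Prop :=
  ∀ y ∈ Ω, ∃ T, IsPrincipal F N (quarterTrace F N y) T y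

lemma Framed.exists_principalFrame (h : Framed Ω F N) (hid : IsIdealOn Ω F N) (hy : y ∈ Ω)
    (ha : quarterTrace F N y ≠ 0) :
    ∃ (Ω' : Set (E 3)) (T : E 3 → E 4), y ∈ Ω' ∧ Ω' ⊆ Ω ∧
      PrincipalFrame Ω' F N (quarterTrace F N) T := by
  obtain ⟨Ω', T, ho, hy', hs, hT, ha', hp⟩ := h.exists_smooth_principal hid hy ha
  exact ⟨Ω', T, hy', hs, { h.mono ho hs with
    smooth_a := h.contDiffOn_quarterTrace.mono hs
    smooth_T := hT
    ne_zero := ha'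
    principal := hp }⟩

lemma IsPrincipal.fderiv_normal_eq_zero {T : E 4} (h : IsPrincipal F N 0 T y) (u : E 3) :
    fderiv ℝ N y u = 0 := by
  rw [h.2.2 u]; simp

/-- The differential of `a` and the trace-adjusted shape operator are proportional. -/
lemma Framed.fderiv_smul_symm (h : Framed Ω F N) (hid : IsIdealOn Ω F N) (hy : y ∈ Ω) (u v : E 3) :
    fderiv ℝ (quarterTrace F N) y v • (fderiv ℝ N y u + quarterTrace F N y • fderiv ℝ F y u) =
      fderiv ℝ (quarterTrace F N) y u •
        (fderiv ℝ N y v + quarterTrace F N y • fderiv ℝ F y v) := by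
  by_cases ha : quarterTrace F N y = 0
  · obtain ⟨T, hT⟩ := hid y hy
    rw [ha] at hT
    simp [ha, hT.fderiv_normal_eq_zero]
  · obtain ⟨Ω', T, hy', hs, hp⟩ := h.exists_principalFrame hid hy ha
    -- Here `da(v) = ak⟪dF v, T⟫` and `dN u + a dF u = -a⟪dF u, T⟫ T`, so both sides are the same
    -- expression, symmetric in `u` and `v`.
    rw [hp.fderiv_a hy', hp.fderiv_a hy', hp.fderiv_N hy', hp.fderiv_N hy']
    module

/-- At a totally geodesic point the differential of `a` vanishes. -/
lemma Framed.fderiv_quarterTrace_eq_zero (h : Framed Ω F N) (hid : IsIdealOn Ω F N) (hy : y ∈ Ω)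
    (ha : quarterTrace F N y = 0) : fderiv ℝ (quarterTrace F N) y = 0 := by
  set a := quarterTrace F N with ha'
  have hN : ∀ u, fderiv ℝ N y u = 0 := by
    obtain ⟨T, hT⟩ := hid y hy
    rw [← ha', ha] at hT
    exact hT.fderiv_normal_eq_zero
  have hsm := h.contDiffOn_quarterTrace
  have hda := hasFDerivAt_of_contDiffOn h.isOpen hsm hy
  have hdda := fun u ↦ hasFDerivAt_fderiv_apply h.isOpen hsm hy u
  by_contra hne
  obtain ⟨v, hv⟩ : ∃ v, fderiv ℝ a y v ≠ 0 := by
    by_contra! hall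
    exact hne (by ext u; simpa using hall u)
  obtain ⟨u, hu0, hu⟩ := exists_ne_zero_apply_eq_zero (fderiv ℝ a y)
  have hQ := fun u ↦ (h.hasFDerivAt_fderiv_normal hy u).add (hda.smul (h.hasFDerivAt_fderiv hy u))
  -- The proportionality relation holds across flat points, hence may be differentiated at one.
  -- There `a`, `dN` and `da(u)` vanish and `da(v)` does not, so only the derivative of `dN u + a dF
  -- u` survives and must be zero.
  have h1 := fderiv_unique_on h.isOpen (fun z hz ↦ h.fderiv_smul_symm hid hz u v) hy
    ((hdda v).smul (hQ u)) ((hdda u).smul (hQ v))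
  have key : ∀ w, fderiv ℝ (fderiv ℝ N) y w u = -(fderiv ℝ a y w) • fderiv ℝ F y u := by
    intro w
    have h2 := DFunLike.congr_fun h1 w
    simp only [← ha'] at h2
    simp [ha, hN, hu] at h2
    rw [← smul_add] at h2
    rw [neg_smul]
    exact eq_neg_of_add_eq_zero_left ((smul_eq_zero.1 h2).resolve_left hv)
  -- Differentiating the symmetry of the shape operator along `u` now gives `da(v) |dF u|² = da(u)
  -- ⟪dF v, dF u⟫ = 0`, a contradiction.
  have h3 := fderiv_unique_on h.isOpen
    (fun z hz ↦ h.inner_fderiv_fderiv_normal_symm hz u v) hy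
    ((h.hasFDerivAt_fderiv hy u).inner ℝ (h.hasFDerivAt_fderiv_normal hy v))
    ((h.hasFDerivAt_fderiv hy v).inner ℝ (h.hasFDerivAt_fderiv_normal hy u))
  have h4 := DFunLike.congr_fun h3 u
  simp [hN] at h4
  rw [h.snd_fderiv_normal_symm hy, key, key, hu] at h4
  simp [inner_smul_right, hv] at h4
  have := h.norm_fderiv_pos hy hu0
  simp [h4] at this

/-- The first integral `a ^ 4 + ‖∇ a‖ ^ 2`. -/
def energy (F N : E 3 → E 4) (y : E 3) : ℝ :=
  quarterTrace F N y ^ 4 + ‖(fderiv ℝ (quarterTrace F N) y).comp (tangentPart F N y)‖ ^ 2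

lemma Framed.continuousOn_energy (h : Framed Ω F N) : ContinuousOn (energy F N) Ω := by
  have h1 := h.contDiffOn_quarterTrace
  have h2 := (contDiffOn_fderiv h.isOpen h1).clm_comp h.contDiffOn_tangentPart
  exact (h1.continuousOn.pow 4).add (h2.continuousOn.norm.pow 2)

/-- The gradient of `a` is `ak T` with `k` the logarithmic derivative. The frame-free definition of
`energy` is thus the conserved quantity of `fderiv_energy`, while remaining meaningful at flat
points. -/
lemma PrincipalFrame.energy_eq {T : E 3 → E 4} (h : PrincipalFrame Ω F N (quarterTrace F N) T)
    (hy : y ∈ Ω) : energy F N y = quarterTrace F N y ^ 4 +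
      (quarterTrace F N y * logDeriv F N (quarterTrace F N) T y) ^ 2 := by
  have h1 : (fderiv ℝ (quarterTrace F N) y).comp (tangentPart F N y) =
      (quarterTrace F N y * logDeriv F N (quarterTrace F N) T y) • innerSL ℝ (T y) := by
    ext1 w
    have h2 : ⟪fderiv ℝ F y (tangentPart F N y w), T y⟫ = ⟪T y, w⟫ := by
      conv_rhs => rw [h.decompose hy w]
      simp [inner_add_right, inner_smul_right, h.inner_T_N hy, real_inner_comm]
    simp [h.fderiv_a hy, h2]
  rw [energy, h1, norm_smul, innerSL_apply_norm, (h.principal y hy).1, mul_one, Real.norm_eq_abs,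
    sq_abs]

lemma Framed.energy_eventually_eq (h : Framed Ω F N) (hid : IsIdealOn Ω F N) (hy : y ∈ Ω)
    (ha : quarterTrace F N y ≠ 0) : ∀ᶠ z in nhds y, z ∈ Ω ∧ energy F N z = energy F N y := by
  obtain ⟨Ω', T, hy', hs, hp⟩ := h.exists_principalFrame hid hy ha
  obtain ⟨r, hr, hb⟩ := Metric.isOpen_iff.1 hp.isOpen y hy'
  filter_upwards [Metric.ball_mem_nhds y hr] with z hz
  refine ⟨hs (hb hz), ?_⟩
  rw [hp.energy_eq (hb hz), hp.energy_eq hy']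
  refine Metric.isOpen_ball.is_const_of_fderiv_eq_zero (𝕜 := ℝ) (convex_ball y r).isPreconnected
    (fun w hw ↦ (hp.fderiv_energy (hb hw)).differentiableAt.differentiableWithinAt)
    (fun w hw ↦ (hp.fderiv_energy (hb hw)).fderiv) hz (Metric.mem_ball_self hr)

/-- A hypersurface with principal curvatures `(a, a, 2 a)` over a connected parameter domain that has
a totally geodesic point is totally geodesic. -/
theorem Framed.quarterTrace_eq_zero (h : Framed Ω F N) (hid : IsIdealOn Ω F N)
    (hΩ : IsPreconnected Ω) {p : E 3} (hp : p ∈ Ω) (ha : quarterTrace F N p = 0) :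
    ∀ y ∈ Ω, quarterTrace F N y = 0 := by
  intro y hy
  have hEp : energy F N p = 0 := by simp [energy, ha, h.fderiv_quarterTrace_eq_zero hid hp ha]
  have hE0 : ∀ z ∈ Ω, quarterTrace F N z = 0 → energy F N z = 0 := fun z hz h0 ↦ by
    simp [energy, h0, h.fderiv_quarterTrace_eq_zero hid hz h0]
  by_contra hne
  have hEy : energy F N y ≠ 0 := by
    have : 0 < quarterTrace F N y ^ 4 := by positivity
    have h2 : 0 ≤ ‖(fderiv ℝ (quarterTrace F N) y).comp (tangentPart F N y)‖ ^ 2 := by positivity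
    rw [energy]; linarith
  set c := energy F N y
  -- The value `c` is nonzero and `energy` vanishes at flat points, so `a ≠ 0` on this level set and
  -- `energy` is locally constant near it. The level set is closed in `Ω` by continuity; it contains
  -- `y` but not `p`.
  have ho1 : IsOpen {z | z ∈ Ω ∧ energy F N z = c} := by
    rw [isOpen_iff_mem_nhds]
    rintro z ⟨hz, hzc⟩
    have haz : quarterTrace F N z ≠ 0 := fun h0 ↦ hEy (by rw [← hzc, hE0 z hz h0])
    filter_upwards [h.energy_eventually_eq hid hz haz] with w hw
    exact ⟨hw.1, hw.2.trans hzc⟩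
  have ho2 : IsOpen (Ω ∩ energy F N ⁻¹' {c}ᶜ) :=
    h.continuousOn_energy.isOpen_inter_preimage h.isOpen isOpen_compl_singleton
  obtain ⟨z, -, hz1, hz2⟩ := hΩ _ _ ho1 ho2
    (fun z hz ↦ by by_cases hzc : energy F N z = c <;> [left; right] <;> exact ⟨hz, hzc⟩)
    ⟨y, hy, hy, rfl⟩ ⟨p, hp, hp, by simpa [hEp] using hEy.symm⟩
  exact hz2.2 hz1.2

end

/-! ### Local rigidity from the fundamental forms -/

section

variable {Ω : Set (E 3)} {F N G N' : E 3 → E 4} {y : E 3}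

/-- The linear map carrying the frame `(dF, N)` to the frame `(dG, N')`. -/
def frameTransfer (F N G N' : E 3 → E 4) (y : E 3) : E 4 →L[ℝ] E 4 :=
  (fderiv ℝ G y).comp (tangentPart F N y) +
    ContinuousLinearMap.smulRightL ℝ (E 4) (E 4) (innerSL ℝ (N y)) (N' y)

lemma frameTransfer_apply (w : E 4) : frameTransfer F N G N' y w =
    fderiv ℝ G y (tangentPart F N y w) + ⟪N y, w⟫ • N' y := by
  simp [frameTransfer]

lemma frameTransfer_fderiv (h : Framed Ω F N) (hy : y ∈ Ω) (u : E 3) :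
    frameTransfer F N G N' y (fderiv ℝ F y u) = fderiv ℝ G y u := by
  rw [frameTransfer_apply, h.tangentPart_fderiv hy, real_inner_comm, h.inner_normal y hy]
  simp

lemma frameTransfer_normal (h : Framed Ω F N) (hy : y ∈ Ω) :
    frameTransfer F N G N' y (N y) = N' y := by
  rw [frameTransfer_apply, h.tangentPart_normal hy]
  simp [h.norm_normal y hy]

set_option synthInstance.maxHeartbeats 200000 in
lemma contDiffOn_frameTransfer (h : Framed Ω F N) (h' : Framed Ω G N') :
    ContDiffOn ℝ ∞ (frameTransfer F N G N') Ω := by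
  refine ((contDiffOn_fderiv h.isOpen h'.contDiffOn).clm_comp h.contDiffOn_tangentPart).add ?_
  have h1 : ContDiffOn ℝ ∞ (fun y ↦ innerSL ℝ (N y)) Ω :=
    (innerSL ℝ (E := E 4)).contDiff.comp_contDiffOn h.contDiffOn_normal
  exact ((ContinuousLinearMap.smulRightL ℝ (E 4) (E 4)).contDiff.comp_contDiffOn h1).clm_apply
    h'.contDiffOn_normal

/-- The parametrized hypersurfaces `F` and `G` induce the same metric. -/
def SameMetric (Ω : Set (E 3)) (F G : E 3 → E 4) : Prop :=
  ∀ y ∈ Ω, ∀ u v, ⟪fderiv ℝ F y u, fderiv ℝ F y v⟫ = ⟪fderiv ℝ G y u, fderiv ℝ G y v⟫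

/-- The tangential part of the second derivative is determined by the metric. -/
lemma SameMetric.inner_snd_fderiv (hg : SameMetric Ω F G) (h : Framed Ω F N) (h' : Framed Ω G N')
    (hy : y ∈ Ω) (w u v : E 3) :
    ⟪fderiv ℝ (fderiv ℝ F) y w u, fderiv ℝ F y v⟫ =
      ⟪fderiv ℝ (fderiv ℝ G) y w u, fderiv ℝ G y v⟫ := by
  have key : ∀ w u v, ⟪fderiv ℝ (fderiv ℝ F) y w u, fderiv ℝ F y v⟫ +
      ⟪fderiv ℝ (fderiv ℝ F) y w v, fderiv ℝ F y u⟫ =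
      ⟪fderiv ℝ (fderiv ℝ G) y w u, fderiv ℝ G y v⟫ +
      ⟪fderiv ℝ (fderiv ℝ G) y w v, fderiv ℝ G y u⟫ := by
    intro w u v
    have h1 := fderiv_unique_on h.isOpen (fun z hz ↦ hg z hz u v) hy
      ((h.hasFDerivAt_fderiv hy u).inner ℝ (h.hasFDerivAt_fderiv hy v))
      ((h'.hasFDerivAt_fderiv hy u).inner ℝ (h'.hasFDerivAt_fderiv hy v))
    have h2 := DFunLike.congr_fun h1 w
    simp at h2
    rw [real_inner_comm (fderiv ℝ (fderiv ℝ F) y w v) (fderiv ℝ F y u),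
      real_inner_comm (fderiv ℝ (fderiv ℝ G) y w v) (fderiv ℝ G y u)] at h2
    linarith
  -- Koszul's argument: the sum of the first two identities minus the third isolates one term, by
  -- symmetry of the second derivative.
  have k1 := key w u v
  have k2 := key u w v
  have k3 := key v w u
  rw [h.snd_fderiv_symm hy u w, h'.snd_fderiv_symm hy u w] at k2
  rw [h.snd_fderiv_symm hy v w, h'.snd_fderiv_symm hy v w, h.snd_fderiv_symm hy v u,
    h'.snd_fderiv_symm hy v u] at k3
  linarith

lemma inner_frameTransfer (h : Framed Ω F N) (h' : Framed Ω G N') (hg : SameMetric Ω F G)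
    (hy : y ∈ Ω) (w z : E 4) :
    ⟪frameTransfer F N G N' y w, frameTransfer F N G N' y z⟫ = ⟪w, z⟫ := by
  conv_rhs => rw [h.decompose hy w, h.decompose hy z]
  have h1 : ∀ u, ⟪N y, fderiv ℝ F y u⟫ = 0 := fun u ↦ by rw [real_inner_comm, h.inner_normal y hy]
  have h2 : ∀ u, ⟪N' y, fderiv ℝ G y u⟫ = 0 := fun u ↦ by
    rw [real_inner_comm, h'.inner_normal y hy]
  simp [frameTransfer_apply, inner_add_left, inner_add_right, inner_smul_left, inner_smul_right,
    h'.inner_normal y hy, h1, h2, hg y hy, h.norm_normal y hy,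
    h'.norm_normal y hy, real_inner_comm (N y)]

/-- The transfer map carries second derivatives of `F` to those of `G` (the tangential part is fixed
by the metric, the normal part by `hb`) and `dN` to `dN'`. Differentiating the identities that carry
one frame to the other then shows that its derivative kills the whole frame. -/
lemma fderiv_frameTransfer (h : Framed Ω F N) (h' : Framed Ω G N') (hg : SameMetric Ω F G)
    (hb : ∀ y ∈ Ω, ∀ u v, ⟪fderiv ℝ (fderiv ℝ F) y u v, N y⟫ =
      ⟪fderiv ℝ (fderiv ℝ G) y u v, N' y⟫) (hy : y ∈ Ω) :
    fderiv ℝ (frameTransfer F N G N') y = 0 := by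
  have hO := hasFDerivAt_of_contDiffOn h.isOpen (contDiffOn_frameTransfer h h') hy
  have hsnd : ∀ w u, frameTransfer F N G N' y (fderiv ℝ (fderiv ℝ F) y w u) =
      fderiv ℝ (fderiv ℝ G) y w u := by
    intro w u
    refine h'.ext_inner hy (fun v ↦ ?_) ?_
    · rw [← frameTransfer_fderiv (G := G) (N' := N') h hy, inner_frameTransfer h h' hg hy,
        frameTransfer_fderiv h hy, real_inner_comm, hg.inner_snd_fderiv h h' hy, real_inner_comm]
    · rw [← hb y hy]
      conv_lhs => rw [← frameTransfer_normal (G := G) (N' := N') h hy]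
      rw [inner_frameTransfer h h' hg hy]
  have hnor : ∀ w, frameTransfer F N G N' y (fderiv ℝ N y w) = fderiv ℝ N' y w := by
    intro w
    refine h'.ext_inner hy (fun v ↦ ?_) ?_
    · rw [← frameTransfer_fderiv (G := G) (N' := N') h hy, inner_frameTransfer h h' hg hy,
        frameTransfer_fderiv h hy]
      have h1 := h.inner_snd_fderiv_normal hy w v
      have h2 := h'.inner_snd_fderiv_normal hy w v
      rw [hb y hy] at h1
      linarith
    · rw [h'.inner_fderiv_normal_self hy]
      conv_lhs => rw [← frameTransfer_normal (G := G) (N' := N') h hy]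
      rw [inner_frameTransfer h h' hg hy, h.inner_fderiv_normal_self hy]
  ext1 w
  have hF : ∀ u, fderiv ℝ (frameTransfer F N G N') y w (fderiv ℝ F y u) = 0 := by
    intro u
    have h1 := fderiv_unique_on h.isOpen
      (fun z hz ↦ frameTransfer_fderiv (G := G) (N' := N') h hz u) hy
      (hO.clm_apply (h.hasFDerivAt_fderiv hy u)) (h'.hasFDerivAt_fderiv hy u)
    have h2 := DFunLike.congr_fun h1 w
    simpa [hsnd] using h2
  have hN : fderiv ℝ (frameTransfer F N G N') y w (N y) = 0 := by
    have h1 := fderiv_unique_on h.isOpen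
      (fun z hz ↦ frameTransfer_normal (G := G) (N' := N') h hz) hy
      (hO.clm_apply (h.hasFDerivAt_normal hy)) (h'.hasFDerivAt_normal hy)
    have h2 := DFunLike.congr_fun h1 w
    simpa [hnor] using h2
  ext1 z
  rw [h.decompose hy z, map_add, map_smul, hF, hN]
  simp

/-- Uniqueness part of the fundamental theorem of hypersurfaces. -/
theorem exists_isometry_of_same_forms (h : Framed Ω F N) (h' : Framed Ω G N')
    (hg : SameMetric Ω F G) (hb : ∀ y ∈ Ω, ∀ u v, ⟪fderiv ℝ (fderiv ℝ F) y u v, N y⟫ =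
      ⟪fderiv ℝ (fderiv ℝ G) y u v, N' y⟫) (hΩ : IsPreconnected Ω) {p : E 3} (hp : p ∈ Ω) :
    ∃ (O : E 4 ≃ₗᵢ[ℝ] E 4) (c : E 4), ∀ y ∈ Ω, G y = O (F y) + c := by
  have hconst : ∀ y ∈ Ω, frameTransfer F N G N' y = frameTransfer F N G N' p := fun y hy ↦
    h.isOpen.is_const_of_fderiv_eq_zero (𝕜 := ℝ) hΩ
      ((contDiffOn_frameTransfer h h').differentiableOn (by simp))
      (fun z hz ↦ fderiv_frameTransfer h h' hg hb hz) hy hp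
  set O₀ := frameTransfer F N G N' p with hO₀
  let O₁ : E 4 →ₗᵢ[ℝ] E 4 := O₀.toLinearMap.isometryOfInner
    (fun w z ↦ inner_frameTransfer h h' hg hp w z)
  let O := O₁.toLinearIsometryEquiv rfl
  have hO : ∀ w, O w = O₀ w := fun w ↦ rfl
  have hd : ∀ y ∈ Ω, HasFDerivAt (fun z ↦ G z - O₀ (F z)) (0 : E 3 →L[ℝ] E 4) y := by
    intro y hy
    refine ((h'.hasFDerivAt hy).sub (O₀.hasFDerivAt.comp y (h.hasFDerivAt hy))).congr_fderiv ?_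
    ext1 u
    simp [← hconst y hy, frameTransfer_fderiv h hy]
  refine ⟨O, G p - O₀ (F p), fun y hy ↦ ?_⟩
  have h1 := h.isOpen.is_const_of_fderiv_eq_zero (𝕜 := ℝ) hΩ
    (fun z hz ↦ (hd z hz).differentiableAt.differentiableWithinAt)
    (fun z hz ↦ (hd z hz).fderiv) hy hp
  rw [hO, ← h1]
  abel

end

/-! ### Pointwise conditions on the second fundamental form -/

section

variable {Ω : Set (E 3)} {F N G N' : E 3 → E 4} {y : E 3}

/-- A hypersurface has a smooth unit normal field near every point. -/
lemma exists_framed (ho : IsOpen Ω) (hF : ContDiffOn ℝ ∞ F Ω)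
    (hinj : ∀ y ∈ Ω, Function.Injective (fderiv ℝ F y)) {p : E 3} (hp : p ∈ Ω) :
    ∃ (Ω' : Set (E 3)) (N : E 3 → E 4), p ∈ Ω' ∧ Ω' ⊆ Ω ∧ Framed Ω' F N := by
  obtain ⟨n, hn0, hn⟩ : ∃ n : E 4, n ≠ 0 ∧ ∀ u, ⟪fderiv ℝ F p u, n⟫ = 0 := by
    have h1 : (LinearMap.range (fderiv ℝ F p).toLinearMap)ᗮ ≠ ⊥ := by
      intro h0
      have h2 := Submodule.orthogonal_eq_bot_iff.1 h0
      have h3 := LinearMap.finrank_range_le (fderiv ℝ F p).toLinearMap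
      rw [h2] at h3
      simp at h3
    obtain ⟨n, hn, hn0⟩ := Submodule.exists_mem_ne_zero_of_ne_bot h1
    exact ⟨n, hn0, fun u ↦ hn _ (LinearMap.mem_range_self _ u)⟩
  let K : E 3 → E 3 × ℝ →L[ℝ] E 4 := fun y ↦ (fderiv ℝ F y).comp (ContinuousLinearMap.fst ℝ (E 3) ℝ)
    + (ContinuousLinearMap.snd ℝ (E 3) ℝ).smulRight n
  have hK : ContDiffOn ℝ ∞ K Ω :=
    ((contDiffOn_fderiv ho hF).clm_comp contDiffOn_const).add contDiffOn_const
  have hKp : Function.Injective (K p) := by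
    rw [injective_iff_map_eq_zero]
    rintro ⟨u, t⟩ hut
    have hut' : fderiv ℝ F p u + t • n = 0 := by simpa [K] using hut
    have h1 := congrArg (fun w ↦ ⟪w, n⟫) hut'
    simp only [inner_add_left, inner_smul_left, hn, inner_zero_left] at h1
    have ht : t = 0 := by simpa [hn0] using h1
    subst ht
    have hu : fderiv ℝ F p u = fderiv ℝ F p 0 := by simpa using hut'
    rw [hinj p hp hu]
    rfl
  let R : Set (E 3 × ℝ →L[ℝ] E 4) := Set.range ((↑) : ((E 3 × ℝ) ≃L[ℝ] E 4) → E 3 × ℝ →L[ℝ] E 4)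
  have hR : IsOpen R := ContinuousLinearEquiv.isOpen
  let Ω' := Ω ∩ K ⁻¹' R
  have hΩ' : IsOpen Ω' := hK.continuousOn.isOpen_inter_preimage ho hR
  have hd : finrank ℝ (E 3 × ℝ) = finrank ℝ (E 4) := by simp
  have hpΩ' : p ∈ Ω' := ⟨hp, (LinearEquiv.ofInjectiveOfFinrankEq (K p).toLinearMap
    hKp hd).toContinuousLinearEquiv, by ext <;> rfl⟩
  -- A normal at `p` stays transversal nearby, so `φ`, the coefficient of `n` in the basis `(dF,
  -- n)`, is defined and smooth. It vanishes on the tangent space; its Riesz representative `N₀` is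
  -- therefore normal.
  let φ : E 3 → E 4 →L[ℝ] ℝ := fun y ↦ (ContinuousLinearMap.snd ℝ (E 3) ℝ).comp (K y).inverse
  have hφ : ContDiffOn ℝ ∞ φ Ω' := by
    refine contDiffOn_const.clm_comp fun y hy ↦ ?_
    obtain ⟨e, he⟩ := hy.2
    have h2 := contDiffAt_map_inverse (n := ∞) e
    rw [he] at h2
    exact h2.comp_contDiffWithinAt y (hK.mono Set.inter_subset_left y hy)
  let N₀ : E 3 → E 4 := fun y ↦ ∑ i, φ y (EuclideanSpace.basisFun (Fin 4) ℝ i) •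
    EuclideanSpace.basisFun (Fin 4) ℝ i
  have hN₀ : ContDiffOn ℝ ∞ N₀ Ω' := ContDiffOn.sum fun i _ ↦
    (hφ.clm_apply contDiffOn_const).smul contDiffOn_const
  have hin : ∀ y w, ⟪w, N₀ y⟫ = φ y w := by
    intro y w
    conv_rhs => rw [← (EuclideanSpace.basisFun (Fin 4) ℝ).sum_repr' w]
    simp only [N₀, inner_sum, inner_smul_right, map_sum, map_smul, smul_eq_mul]
    refine Finset.sum_congr rfl fun i _ ↦ ?_
    rw [mul_comm, real_inner_comm]
  have hφF : ∀ y ∈ Ω', ∀ u t, φ y (fderiv ℝ F y u + t • n) = t := by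
    rintro y ⟨-, e, he⟩ u t
    have h1 : fderiv ℝ F y u + t • n = e (u, t) := by
      change _ = (e : E 3 × ℝ →L[ℝ] E 4) (u, t)
      rw [he]; simp [K]
    simp only [φ, ← he, h1]
    simp
  have hne : ∀ y ∈ Ω', N₀ y ≠ 0 := by
    intro y hy h0
    have h1 := hφF y hy 0 1
    rw [← hin, h0] at h1
    simp at h1
  refine ⟨Ω', fun y ↦ ‖N₀ y‖⁻¹ • N₀ y, hpΩ', Set.inter_subset_left, hΩ',
    hF.mono Set.inter_subset_left, ?_, fun y hy ↦ hinj y hy.1, fun y hy ↦ ?_, fun y hy u ↦ ?_⟩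
  · exact ((hN₀.norm ℝ hne).inv fun y hy ↦ norm_ne_zero_iff.2 (hne y hy)).smul hN₀
  · have := norm_ne_zero_iff.2 (hne y hy)
    simp [norm_smul, this]
  · have h1 := hφF y hy u 0
    simp only [zero_smul, add_zero] at h1
    simp [inner_smul_right, hin, h1]

/-- The unit normal is unique up to sign. -/
lemma Framed.normal_unique (h : Framed Ω F N) (hy : y ∈ Ω) {n : E 4} (hn : ‖n‖ = 1)
    (hn' : ∀ u, ⟪fderiv ℝ F y u, n⟫ = 0) : n = N y ∨ n = -N y := by
  have h1 : n = ⟪n, N y⟫ • N y := by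
    refine h.ext_inner hy (fun u ↦ ?_) ?_
    · simp [hn', inner_smul_right, h.inner_normal y hy]
    · simp [inner_smul_left, h.norm_normal y hy]
  have h2 : |⟪n, N y⟫| = 1 := by
    have := congrArg norm h1
    simpa [norm_smul, h.norm_normal y hy, hn] using this.symm
  rcases eq_or_eq_neg_of_abs_eq h2 with h3 | h3 <;> rw [h3] at h1
  · left; simpa using h1
  · right; simpa using h1

/-- The second fundamental form of `F` at `y` has eigenvalues `(a, a, 2 a)`. -/
def HasIdealForm (F : E 3 → E 4) (y : E 3) : Prop :=
  ∃ (n T : E 4) (a : ℝ), ‖n‖ = 1 ∧ (∀ u, ⟪fderiv ℝ F y u, n⟫ = 0) ∧ ‖T‖ = 1 ∧ ⟪T, n⟫ = 0 ∧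
    ∀ u v, ⟪fderiv ℝ (fderiv ℝ F) y u v, n⟫ =
      a * (⟪fderiv ℝ F y u, fderiv ℝ F y v⟫ + ⟪fderiv ℝ F y u, T⟫ * ⟪fderiv ℝ F y v, T⟫)

/-- The second fundamental forms of `F` and `G` at `y` agree up to the choice of the normals. -/
def SameForm (F G : E 3 → E 4) (y : E 3) : Prop :=
  ∃ n n' : E 4, ‖n‖ = 1 ∧ (∀ u, ⟪fderiv ℝ F y u, n⟫ = 0) ∧
    ‖n'‖ = 1 ∧ (∀ u, ⟪fderiv ℝ G y u, n'⟫ = 0) ∧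
    ∀ u v, ⟪fderiv ℝ (fderiv ℝ F) y u v, n⟫ = ⟪fderiv ℝ (fderiv ℝ G) y u v, n'⟫

/-- The second fundamental form of `F` at `y` vanishes. -/
def IsFlatAt (F : E 3 → E 4) (y : E 3) : Prop :=
  ∀ n, (∀ u, ⟪fderiv ℝ F y u, n⟫ = 0) → ∀ u v, ⟪fderiv ℝ (fderiv ℝ F) y u v, n⟫ = 0

lemma HasIdealForm.exists_normal (h : HasIdealForm F y) (hF : Framed Ω F N) (hy : y ∈ Ω) :
    ∃ (T : E 4) (a : ℝ), ‖T‖ = 1 ∧ ⟪T, N y⟫ = 0 ∧ ∀ u v, ⟪fderiv ℝ (fderiv ℝ F) y u v, N y⟫ =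
      a * (⟪fderiv ℝ F y u, fderiv ℝ F y v⟫ + ⟪fderiv ℝ F y u, T⟫ * ⟪fderiv ℝ F y v, T⟫) := by
  obtain ⟨n, T, a, hn, hn', hT, hTn, hform⟩ := h
  rcases hF.normal_unique hy hn hn' with rfl | rfl
  · exact ⟨T, a, hT, hTn, hform⟩
  · refine ⟨T, -a, hT, by simpa using hTn, fun u v ↦ ?_⟩
    have := hform u v
    rw [inner_neg_right] at this
    linarith

lemma HasIdealForm.isPrincipal (h : HasIdealForm F y) (hF : Framed Ω F N) (hy : y ∈ Ω) :
    ∃ T, IsPrincipal F N (quarterTrace F N y) T y := by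
  obtain ⟨T, a, hT, hTn, hform⟩ := h.exists_normal hF hy
  have hp : IsPrincipal F N a T y := by
    refine ⟨hT, hTn, fun u ↦ hF.ext_inner hy (fun v ↦ ?_) ?_⟩
    · have h1 := hF.inner_snd_fderiv_normal hy u v
      rw [hform] at h1
      simp only [inner_smul_right, inner_add_right]
      rw [real_inner_comm] at h1
      linarith
    · rw [hF.inner_fderiv_normal_self hy]
      simp [inner_smul_left, inner_add_left, hF.inner_normal y hy, hTn]
  exact ⟨T, by rwa [hp.quarterTrace_eq hF hy]⟩

lemma IsPrincipal.inner_snd_fderiv {a : ℝ} {T : E 4} (h : IsPrincipal F N a T y)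
    (hF : Framed Ω F N) (hy : y ∈ Ω) (u : E 3) : ⟪fderiv ℝ (fderiv ℝ F) y u u, N y⟫ =
      a * (⟪fderiv ℝ F y u, fderiv ℝ F y u⟫ + ⟪fderiv ℝ F y u, T⟫ ^ 2) := by
  rw [hF.inner_snd_fderiv_normal hy, h.2.2]
  simp only [inner_smul_right, inner_add_right]
  ring

/-- The eigenvalues `a, a, 2a` have one sign, so the form is definite. A single fixed direction
hence detects nonflatness at every point. -/
lemma IsPrincipal.inner_snd_fderiv_ne_zero {a : ℝ} {T : E 4} (h : IsPrincipal F N a T y)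
    (hF : Framed Ω F N) (hy : y ∈ Ω) (ha : a ≠ 0) {u : E 3} (hu : u ≠ 0) :
    ⟪fderiv ℝ (fderiv ℝ F) y u u, N y⟫ ≠ 0 := by
  rw [h.inner_snd_fderiv hF hy]
  have := hF.norm_fderiv_pos hy hu
  positivity

lemma IsPrincipal.isFlatAt_iff {a : ℝ} {T : E 4} (h : IsPrincipal F N a T y)
    (hF : Framed Ω F N) (hy : y ∈ Ω) : IsFlatAt F y ↔ a = 0 := by
  constructor
  · intro hfl
    by_contra ha
    obtain ⟨u, hu⟩ := exists_ne (0 : E 3)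
    exact h.inner_snd_fderiv_ne_zero hF hy ha hu (hfl _ (hF.inner_normal y hy) u u)
  · rintro rfl n hn u v
    have h1 : n = ⟪n, N y⟫ • N y := by
      refine hF.ext_inner hy (fun u ↦ ?_) ?_
      · simp [hn, inner_smul_right, hF.inner_normal y hy]
      · simp [inner_smul_left, hF.norm_normal y hy]
    rw [h1, inner_smul_right, hF.inner_snd_fderiv_normal hy, h.fderiv_normal_eq_zero]
    simp

/-- Flatness propagates along connected parameter domains. -/
lemma isFlatAt_of_isFlatAt (hF : Framed Ω F N) (hid : ∀ y ∈ Ω, HasIdealForm F y)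
    (hΩ : IsPreconnected Ω) {p : E 3} (hp : p ∈ Ω) (hfl : IsFlatAt F p) (hy : y ∈ Ω) :
    IsFlatAt F y := by
  have hid' : IsIdealOn Ω F N := fun z hz ↦ (hid z hz).isPrincipal hF hz
  obtain ⟨T, hT⟩ := hid' p hp
  obtain ⟨S, hS⟩ := hid' y hy
  exact (hS.isFlatAt_iff hF hy).2
    (hF.quarterTrace_eq_zero hid' hΩ hp ((hT.isFlatAt_iff hF hp).1 hfl) y hy)

lemma Framed.neg (h : Framed Ω F N) : Framed Ω F (-N) where
  isOpen := h.isOpen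
  contDiffOn := h.contDiffOn
  contDiffOn_normal := h.contDiffOn_normal.neg
  injective := h.injective
  norm_normal y hy := by simp [h.norm_normal y hy]
  inner_normal y hy u := by simp [h.inner_normal y hy]

/-- Local rigidity of nowhere flat ideal hypersurfaces. -/
lemma exists_isometry_of_sameForm (h : Framed Ω F N) (h' : Framed Ω G N')
    (hid : ∀ y ∈ Ω, HasIdealForm F y) (hfl : ∀ y ∈ Ω, ¬ IsFlatAt F y) (hg : SameMetric Ω F G)
    (hs : ∀ y ∈ Ω, SameForm F G y) (hΩ : IsPreconnected Ω) {p : E 3} (hp : p ∈ Ω) :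
    ∃ (O : E 4 ≃ₗᵢ[ℝ] E 4) (c : E 4), ∀ y ∈ Ω, G y = O (F y) + c := by
  obtain ⟨w, hw⟩ := exists_ne (0 : E 3)
  have hne : ∀ {y}, y ∈ Ω → ⟪fderiv ℝ (fderiv ℝ F) y w w, N y⟫ ≠ 0 := fun {y} hy ↦ by
    obtain ⟨T, hT⟩ := (hid y hy).isPrincipal h hy
    exact hT.inner_snd_fderiv_ne_zero h hy
      (fun h0 ↦ hfl y hy ((hT.isFlatAt_iff h hy).2 h0)) hw
  have hpm : ∀ y ∈ Ω, (∀ u v, ⟪fderiv ℝ (fderiv ℝ G) y u v, N' y⟫ =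
      ⟪fderiv ℝ (fderiv ℝ F) y u v, N y⟫) ∨ (∀ u v, ⟪fderiv ℝ (fderiv ℝ G) y u v, N' y⟫ =
      -⟪fderiv ℝ (fderiv ℝ F) y u v, N y⟫) := by
    intro y hy
    obtain ⟨n, n', h1, h2, h3, h4, h5⟩ := hs y hy
    rcases h.normal_unique hy h1 h2 with rfl | rfl <;>
      rcases h'.normal_unique hy h3 h4 with rfl | rfl
    · exact Or.inl fun u v ↦ (h5 u v).symm
    · exact Or.inr fun u v ↦ by rw [h5 u v, inner_neg_right, neg_neg]
    · exact Or.inr fun u v ↦ by rw [← h5 u v, inner_neg_right]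
    · exact Or.inl fun u v ↦ by have := h5 u v; simp only [inner_neg_right] at this; linarith
  have hc : ∀ {F N : E 3 → E 4}, Framed Ω F N →
      ContinuousOn (fun y ↦ ⟪fderiv ℝ (fderiv ℝ F) y w w, N y⟫) Ω := fun h ↦
    ((((contDiffOn_fderiv h.isOpen (contDiffOn_fderiv h.isOpen h.contDiffOn)).clm_apply
      contDiffOn_const).clm_apply contDiffOn_const).inner ℝ h.contDiffOn_normal).continuousOn
  -- The sign relating the two forms could depend on the point. Their values on `(w, w)` are
  -- continuous with equal squares and do not vanish for `F`, so on a preconnected set the sign is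
  -- constant; in the negative case `N'` is reversed.
  rcases hΩ.eq_or_eq_neg_of_sq_eq (hc h') (hc h) (fun y hy ↦ by
    rcases hpm y hy with h0 | h0 <;> simp [h0]) hne with heq | heq
  · refine exists_isometry_of_same_forms h h' hg (fun y hy u v ↦ ?_) hΩ hp
    rcases hpm y hy with h0 | h0
    · exact (h0 u v).symm
    · have h1 := heq hy
      have h2 := h0 w w
      have h3 := hne hy
      exact absurd (by linarith) h3
  · refine exists_isometry_of_same_forms h h'.neg hg (fun y hy u v ↦ ?_) hΩ hp
    rcases hpm y hy with h0 | h0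
    · have h1 := heq hy
      have h2 := h0 w w
      have h3 := hne hy
      simp only [Pi.neg_apply] at h1
      exact absurd (by linarith) h3
    · simp [h0]

end

/-! ### Algebra of symmetric bilinear forms in dimension three -/

section Algebra

variable {V : Type*} [NormedAddCommGroup V] [InnerProductSpace ℝ V]

/-- The sum of the squares of the entries of a symmetric bilinear form does not depend on the
orthonormal basis, and neither does its trace. -/
lemma exists_traces [FiniteDimensional ℝ V] (B : LinearMap.BilinForm ℝ V)
    (hB : ∀ u v, B u v = B v u) : ∃ t s : ℝ, ∀ {ι : Type} [Fintype ι] (e : OrthonormalBasis ι ℝ V),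
      ∑ i, B (e i) (e i) = t ∧ ∑ i, ∑ j, B (e i) (e j) ^ 2 = s := by
  let b := stdOrthonormalBasis ℝ V
  -- The self-adjoint operator representing `B`; the two invariants are the traces of `A` and `A²`.
  let A : V →ₗ[ℝ] V := ∑ i, (B (b i)).smulRight (b i)
  have hA : ∀ u v, ⟪u, A v⟫ = B u v := by
    intro u v
    conv_rhs => rw [← b.sum_repr' u]
    simp only [A, LinearMap.sum_apply, LinearMap.smulRight_apply, inner_sum, inner_smul_right,
      map_sum, map_smul, LinearMap.smul_apply, smul_eq_mul]
    exact Finset.sum_congr rfl fun i _ ↦ by rw [mul_comm, real_inner_comm]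
  refine ⟨LinearMap.trace ℝ V A, LinearMap.trace ℝ V (A ∘ₗ A), fun {ι} _ e ↦ ⟨?_, ?_⟩⟩
  · rw [LinearMap.trace_eq_sum_inner A e]
    simp [hA]
  · rw [LinearMap.trace_eq_sum_inner _ e]
    refine Finset.sum_congr rfl fun i _ ↦ ?_
    rw [LinearMap.comp_apply, hA, hB, ← hA, ← e.sum_inner_mul_inner]
    refine Finset.sum_congr rfl fun j _ ↦ ?_
    rw [real_inner_comm, hA, hB]
    ring

lemma sum_lt_eq_half {ι : Type*} [Fintype ι] [LinearOrder ι] (S : ι → ι → ℝ)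
    (hs : ∀ i j, S i j = S j i) (h0 : ∀ i, S i i = 0) :
    ∑ i, ∑ j, (if i < j then S i j else 0) = (1 / 2) * ∑ i, ∑ j, S i j := by
  have h1 : ∑ i, ∑ j, S i j = ∑ i, ∑ j, (if i < j then S i j else 0) +
      ∑ i, ∑ j, (if j < i then S i j else 0) := by
    simp only [← Finset.sum_add_distrib]
    refine Finset.sum_congr rfl fun i _ ↦ Finset.sum_congr rfl fun j _ ↦ ?_
    rcases lt_trichotomy i j with h | h | h
    · simp [h, h.le]
    · simp [h, h0]
    · simp [h, h.le]
  have h2 : ∑ i, ∑ j, (if j < i then S i j else 0) = ∑ i, ∑ j, (if i < j then S i j else 0) := by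
    rw [Finset.sum_comm]
    simp [hs]
  rw [h1, h2]; ring

/-- The sum of squares of the entries of `B` on a pair of vectors. -/
def pairSq (B : LinearMap.BilinForm ℝ V) (v : Fin 3 → V) : ℝ :=
  B (v 0) (v 0) ^ 2 + B (v 0) (v 1) ^ 2 + (B (v 1) (v 0) ^ 2 + B (v 1) (v 1) ^ 2)

/-- Orthonormal frames form a compact set and `pairSq` is continuous. An attained minimum bounds the
infimum over planes from below by a value in an explicit frame. -/
lemma exists_orthonormalBasis_min (hV : finrank ℝ V = 3) (B : LinearMap.BilinForm ℝ V) :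
    ∃ b : OrthonormalBasis (Fin 3) ℝ V, ∀ b' : OrthonormalBasis (Fin 3) ℝ V,
      pairSq B b ≤ pairSq B b' := by
  have : FiniteDimensional ℝ V := FiniteDimensional.of_finrank_pos (by omega)
  have hBc : Continuous fun p : V × V ↦ B p.1 p.2 := by
    let B' : V →ₗ[ℝ] V →L[ℝ] ℝ := LinearMap.toContinuousLinearMap.toLinearMap ∘ₗ B
    have : Continuous fun p : V × V ↦ (LinearMap.toContinuousLinearMap B') p.1 p.2 := by fun_prop
    exact this
  have hq : Continuous (pairSq B) := by
    have h : ∀ i j : Fin 3, Continuous fun v : Fin 3 → V ↦ B (v i) (v j) := fun i j ↦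
      hBc.comp (f := fun v : Fin 3 → V ↦ (v i, v j)) (by fun_prop)
    exact (((h 0 0).pow 2).add ((h 0 1).pow 2)).add (((h 1 0).pow 2).add ((h 1 1).pow 2))
  let S : Set (Fin 3 → V) := {v | Orthonormal ℝ v}
  have hS : IsCompact S := by
    refine Metric.isCompact_of_isClosed_isBounded ?_ ?_
    · have : S = ⋂ i, ⋂ j, {v : Fin 3 → V | ⟪v i, v j⟫ = if i = j then (1 : ℝ) else 0} := by
        ext v; simp [S, orthonormal_iff_ite]
      rw [this]
      exact isClosed_iInter fun i ↦ isClosed_iInter fun j ↦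
        isClosed_eq (by fun_prop) continuous_const
    · refine (Metric.isBounded_closedBall (x := (0 : Fin 3 → V)) (r := 1)).subset fun v hv ↦ ?_
      rw [mem_closedBall_zero_iff, pi_norm_le_iff_of_nonneg zero_le_one]
      exact fun i ↦ (hv.1 i).le
  let b₀ : OrthonormalBasis (Fin 3) ℝ V := (stdOrthonormalBasis ℝ V).reindex (finCongr hV)
  obtain ⟨v, hv, hmin⟩ := hS.exists_isMinOn ⟨b₀, b₀.orthonormal⟩ hq.continuousOn
  have hspan : ⊤ ≤ Submodule.span ℝ (Set.range v) :=
    (hv.linearIndependent.span_eq_top_of_card_eq_finrank' (by simp [hV])).ge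
  refine ⟨OrthonormalBasis.mk hv hspan, fun b' ↦ ?_⟩
  rw [OrthonormalBasis.coe_mk]
  exact hmin b'.orthonormal

lemma casorati_eq_pairSq [FiniteDimensional ℝ V] (hV : finrank ℝ V = 3)
    (B : LinearMap.BilinForm ℝ V) (L : Submodule ℝ V)
    (hL : finrank ℝ L + 1 = 3) : ∃ b : OrthonormalBasis (Fin 3) ℝ V,
      (1 / (finrank ℝ L : ℝ)) * ∑ i, ∑ j, B (stdOrthonormalBasis ℝ L i : V)
        (stdOrthonormalBasis ℝ L j) ^ 2 = (1 / 2) * pairSq B b := by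
  have h2 : finrank ℝ L = 2 := by omega
  let e := (stdOrthonormalBasis ℝ L).reindex (finCongr h2)
  have he : Orthonormal ℝ (fun i ↦ (e i : V)) := e.orthonormal.comp_linearIsometry L.subtypeₗᵢ
  let v : Fin 3 → V := ![e 0, e 1, 0]
  have hv : Orthonormal ℝ (({0, 1} : Set (Fin 3)).domRestrict v) := by
    rw [orthonormal_iff_ite] at he ⊢
    rintro ⟨i, hi⟩ ⟨j, hj⟩
    rcases hi with rfl | rfl <;> rcases hj with rfl | rfl
    · simpa [Set.domRestrict, v] using he 0 0
    · rw [if_neg fun hc ↦ absurd (congrArg Subtype.val hc) (by decide)]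
      simpa [Set.domRestrict, v] using he 0 1
    · rw [if_neg fun hc ↦ absurd (congrArg Subtype.val hc) (by decide)]
      simpa [Set.domRestrict, v] using he 1 0
    · simpa [Set.domRestrict, v] using he 1 1
  obtain ⟨b, hb⟩ := hv.exists_orthonormalBasis_extension_of_card_eq (by simp [hV])
  refine ⟨b, ?_⟩
  have hb0 : b 0 = e 0 := hb 0 (by simp)
  have hb1 : b 1 = e 1 := hb 1 (by simp)
  have hsum : ∑ i, ∑ j, B (stdOrthonormalBasis ℝ L i : V) (stdOrthonormalBasis ℝ L j) ^ 2 =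
      ∑ i, ∑ j, B (e i : V) (e j) ^ 2 := by
    refine Fintype.sum_equiv (finCongr h2) _ _ fun i ↦
      Fintype.sum_equiv (finCongr h2) _ _ fun j ↦ ?_
    simp [e]
  rw [hsum, h2, pairSq, hb0, hb1]
  simp [Fin.sum_univ_two]

lemma pairSq_eq_casorati [FiniteDimensional ℝ V] (B : LinearMap.BilinForm ℝ V)
    (hB : ∀ u v, B u v = B v u) (b : OrthonormalBasis (Fin 3) ℝ V) :
    ∃ L : Submodule ℝ V, finrank ℝ L + 1 = 3 ∧ (1 / 2) * pairSq B b = (1 / (finrank ℝ L : ℝ)) *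
      ∑ i, ∑ j, B (stdOrthonormalBasis ℝ L i : V) (stdOrthonormalBasis ℝ L j) ^ 2 := by
  let v : Fin 2 → V := ![b 0, b 1]
  have hv : Orthonormal ℝ v := by
    have h := b.orthonormal
    rw [orthonormal_iff_ite] at h ⊢
    intro i j
    fin_cases i <;> fin_cases j <;> simp [v]
  let L : Submodule ℝ V := Submodule.span ℝ (Set.range v)
  have hvL : ∀ i, v i ∈ L := fun i ↦ Submodule.subset_span ⟨i, rfl⟩
  have h2 : finrank ℝ L = 2 := by simpa using finrank_span_eq_card hv.linearIndependent
  let w : Fin 2 → L := fun i ↦ ⟨v i, hvL i⟩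
  have hw : Orthonormal ℝ w := by
    rw [orthonormal_iff_ite] at hv ⊢
    exact hv
  let e : OrthonormalBasis (Fin 2) ℝ L := OrthonormalBasis.mk hw
    (hw.linearIndependent.span_eq_top_of_card_eq_finrank' (by simp [h2])).ge
  have he : ∀ i, (e i : V) = v i := fun i ↦ by simp [e, w]
  obtain ⟨t, s, hts⟩ := exists_traces (B.compl₁₂ L.subtype L.subtype) (fun u v ↦ hB u v)
  have h3 := (hts e).2
  have h4 := (hts (stdOrthonormalBasis ℝ L)).2
  simp only [LinearMap.compl₁₂_apply, Submodule.subtype_apply] at h3 h4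
  refine ⟨L, by omega, ?_⟩
  rw [h4, ← h3, h2, pairSq]
  simp [Fin.sum_univ_two, he, v]

/-- The equality case of the optimal inequality between the normalized scalar curvature and the
`δ`-Casorati curvature, for the second fundamental form of a hypersurface of dimension three. -/
lemma exists_eq_of_casorati_ideal [FiniteDimensional ℝ V] (hV : finrank ℝ V = 3)
    (B : LinearMap.BilinForm ℝ V) (hB : ∀ u v, B u v = B v u) {t s : ℝ}
    (hts : ∀ e : OrthonormalBasis (Fin 3) ℝ V,
      ∑ i, B (e i) (e i) = t ∧ ∑ i, ∑ j, B (e i) (e j) ^ 2 = s)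
    (h : (t ^ 2 - s) / 6 = (1 / 2) * ((1 / 3) * s) + (2 / 3) *
      sInf {c : ℝ | ∃ L : Submodule ℝ V, finrank ℝ L + 1 = 3 ∧ c = (1 / (finrank ℝ L : ℝ)) *
        ∑ i, ∑ j, B (stdOrthonormalBasis ℝ L i : V) (stdOrthonormalBasis ℝ L j) ^ 2}) :
    ∃ (ξ : V) (a : ℝ), ‖ξ‖ = 1 ∧ ∀ u v, B u v = a * (⟪u, v⟫ + ⟪u, ξ⟫ * ⟪v, ξ⟫) := by
  obtain ⟨b, hb⟩ := exists_orthonormalBasis_min hV B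
  set S := {c : ℝ | ∃ L : Submodule ℝ V, finrank ℝ L + 1 = 3 ∧ c = (1 / (finrank ℝ L : ℝ)) *
        ∑ i, ∑ j, B (stdOrthonormalBasis ℝ L i : V) (stdOrthonormalBasis ℝ L j) ^ 2}
  have hinf : (1 / 2) * pairSq B b ≤ sInf S := by
    refine le_csInf ⟨_, pairSq_eq_casorati B hB b⟩ ?_
    rintro c ⟨L, hL, rfl⟩
    obtain ⟨b', hb'⟩ := casorati_eq_pairSq hV B L hL
    rw [hb']
    linarith [hb b']
  obtain ⟨ht, hs⟩ := hts b
  simp only [Fin.sum_univ_three, hB (b 1) (b 0), hB (b 2) (b 0), hB (b 2) (b 1)] at ht hs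
  simp only [pairSq, hB (b 1) (b 0)] at hinf
  set x := B (b 0) (b 0) with hx
  set y := B (b 1) (b 1) with hy
  set z := B (b 2) (b 2) with hz
  set p := B (b 0) (b 1) with hp
  set q := B (b 0) (b 2) with hq
  set r := B (b 1) (b 2) with hr
  -- Clearing denominators, equality and `hinf` give `2s + 2(x² + y² + 2p²) - t² ≤ 0`, and half the
  -- left side is this sum of squares. Its vanishing forces a diagonal form with `x = y` and `z =
  -- 2x`.
  have hle : (1 / 2) * (x + y - z) ^ 2 + (x - y) ^ 2 + 4 * p ^ 2 + 2 * q ^ 2 + 2 * r ^ 2 ≤ 0 := by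
    rw [← ht, ← hs] at h
    nlinarith
  have h1 := sq_nonneg (x + y - z)
  have h2 := sq_nonneg (x - y)
  have h3 := sq_nonneg p
  have h4 := sq_nonneg q
  have h5 := sq_nonneg r
  have e1 : x + y - z = 0 := pow_eq_zero_iff (two_ne_zero) |>.1 (by linarith)
  have e2 : x - y = 0 := pow_eq_zero_iff (two_ne_zero) |>.1 (by linarith)
  have e3 : p = 0 := pow_eq_zero_iff (two_ne_zero) |>.1 (by linarith)
  have e4 : q = 0 := pow_eq_zero_iff (two_ne_zero) |>.1 (by linarith)
  have e5 : r = 0 := pow_eq_zero_iff (two_ne_zero) |>.1 (by linarith)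
  refine ⟨b 2, x, b.orthonormal.1 2, fun u v ↦ ?_⟩
  rw [← b.sum_inner_mul_inner u v]
  conv_lhs => rw [← b.sum_repr' u, ← b.sum_repr' v]
  simp only [Fin.sum_univ_three, map_add, map_smul, LinearMap.add_apply, LinearMap.smul_apply,
    smul_eq_mul, hB (b 1) (b 0), hB (b 2) (b 0), hB (b 2) (b 1), ← hx, ← hy, ← hz, ← hp, ← hq,
    ← hr, e3, e4, e5]
  rw [real_inner_comm u (b 0), real_inner_comm u (b 1), real_inner_comm u (b 2),
    real_inner_comm v (b 2)]
  have hyx : y = x := by linarith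
  have hzx : z = 2 * x := by linarith
  rw [hyx, hzx]
  ring

/-- Algebraic rigidity: the curvature tensor determines a second fundamental form with eigenvalues
`(a, a, 2 a)`, `a ≠ 0`, up to sign. -/
lemma eq_or_eq_neg_of_same_curvature (hV : finrank ℝ V = 3) (B B' : LinearMap.BilinForm ℝ V)
    (hB' : ∀ u v, B' u v = B' v u) {ξ : V} {a : ℝ} (ha : a ≠ 0) (hξ : ‖ξ‖ = 1)
    (hB : ∀ u v, B u v = a * (⟪u, v⟫ + ⟪u, ξ⟫ * ⟪v, ξ⟫))
    (h : ∀ u v w z, B u z * B v w - B u w * B v z = B' u z * B' v w - B' u w * B' v z) :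
    (∀ u v, B' u v = B u v) ∨ (∀ u v, B' u v = -B u v) := by
  have : FiniteDimensional ℝ V := FiniteDimensional.of_finrank_pos (by omega)
  -- Only index 2 is prescribed; the zeros are placeholders.
  let v : Fin 3 → V := ![0, 0, ξ]
  have hv : Orthonormal ℝ (({2} : Set (Fin 3)).domRestrict v) := by
    rw [orthonormal_iff_ite]
    rintro ⟨i, rfl⟩ ⟨j, rfl⟩
    simp [Set.domRestrict, v, hξ]
  obtain ⟨b, hb⟩ := hv.exists_orthonormalBasis_extension_of_card_eq (by simp [hV])
  have hb2 : b 2 = ξ := hb 2 (by simp)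
  have o := orthonormal_iff_ite.1 b.orthonormal
  have b00 : B (b 0) (b 0) = a := by rw [hB, ← hb2, o, o]; simp
  have b11 : B (b 1) (b 1) = a := by rw [hB, ← hb2, o, o]; simp
  have b22 : B (b 2) (b 2) = 2 * a := by rw [hB, ← hb2, o]; norm_num; ring
  have bij : ∀ i j, i ≠ j → B (b i) (b j) = 0 := fun i j hij ↦ by
    have h3 : ¬ (i = 2 ∧ j = 2) := fun hc ↦ hij (hc.1.trans hc.2.symm)
    rw [hB, ← hb2, o, o, o, if_neg hij]
    by_cases hi : i = 2 <;> by_cases hj : j = 2 <;> simp_all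
  have b01 := bij 0 1 (by decide)
  have b10 := bij 1 0 (by decide)
  have b02 := bij 0 2 (by decide)
  have b20 := bij 2 0 (by decide)
  have b12 := bij 1 2 (by decide)
  have b21 := bij 2 1 (by decide)
  have k1 := h (b 0) (b 1) (b 1) (b 0)
  have k2 := h (b 0) (b 2) (b 2) (b 0)
  have k3 := h (b 1) (b 2) (b 2) (b 1)
  have k4 := h (b 0) (b 1) (b 2) (b 0)
  have k5 := h (b 1) (b 0) (b 2) (b 1)
  have k6 := h (b 2) (b 0) (b 1) (b 2)
  simp only [b00, b11, b22, b01, b10, b02, b20, b12, b21, hB' (b 1) (b 0), hB' (b 2) (b 0),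
    hB' (b 2) (b 1)] at k1 k2 k3 k4 k5 k6
  set x := B' (b 0) (b 0) with hx
  set y := B' (b 1) (b 1) with hy
  set z := B' (b 2) (b 2) with hz
  set p := B' (b 0) (b 1) with hp
  set q := B' (b 0) (b 2) with hq
  set r := B' (b 1) (b 2) with hr
  -- The hypotheses `k1` to `k6` give all 2×2 minors of the matrix of `B'`: the off-diagonal ones
  -- vanish, the diagonal ones are `a²`, `2a²`, `2a²`. Expanding a row against the cofactors of a
  -- different row gives zero, and only one off-diagonal entry times a nonzero minor remains. So
  -- `B'` is diagonal.
  have ha2 : a * a ≠ 0 := mul_ne_zero ha ha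
  have e3 : p = 0 := by
    have : (a * a) * p = 0 := by
      linear_combination (1 / 2) * p * k2 - (1 / 2) * x * k6 - (1 / 2) * q * k4
    exact (mul_eq_zero.1 this).resolve_left ha2
  have e4 : q = 0 := by
    have : (a * a) * q = 0 := by linear_combination q * k1 - x * k5 - p * k4
    exact (mul_eq_zero.1 this).resolve_left ha2
  have e5 : r = 0 := by
    have : (a * a) * r = 0 := by linear_combination r * k1 - y * k4 - p * k5
    exact (mul_eq_zero.1 this).resolve_left ha2
  rw [e3] at k1
  rw [e4] at k2
  rw [e5] at k3
  have hz0 : z ≠ 0 := by rintro h0; apply ha2; rw [h0] at k2; linarith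
  have hxy : x = y := mul_right_cancel₀ hz0 (by linarith)
  have hxa : x * x = a * a := by rw [← hxy] at k1; linarith
  have hx0 : x ≠ 0 := by rintro h0; rw [h0] at hxa; exact ha2 (by linarith)
  have hzx : z = 2 * x := mul_left_cancel₀ hx0 (by linarith)
  have key : ∀ u v, B' u v = x * (⟪u, v⟫ + ⟪u, ξ⟫ * ⟪v, ξ⟫) := by
    intro u v
    rw [← b.sum_inner_mul_inner u v, ← hb2]
    conv_lhs => rw [← b.sum_repr' u, ← b.sum_repr' v]
    simp only [Fin.sum_univ_three, map_add, map_smul, LinearMap.add_apply, LinearMap.smul_apply,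
      smul_eq_mul, hB' (b 1) (b 0), hB' (b 2) (b 0), hB' (b 2) (b 1), ← hx, ← hy, ← hz, ← hp, ← hq,
      ← hr, e3, e4, e5]
    rw [real_inner_comm u (b 0), real_inner_comm u (b 1), real_inner_comm u (b 2),
      real_inner_comm v (b 2), ← hxy, hzx]
    ring
  rcases mul_self_eq_mul_self_iff.1 hxa with h1 | h1
  · left; intro u v; rw [key, hB, h1]
  · right; intro u v; rw [key, hB, h1]; ring

end Algebra

/-! ### Immersions read in charts -/

section Charts

variable {M : Type*} [TopologicalSpace M] [ChartedSpace (E 3) M]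

/-- The map `f` read in the chart at `x`. -/
def param (f : M → E 4) (x : M) : E 3 → E 4 := f ∘ (extChartAt (𝓡 3) x).symm

lemma coord_add (x : M) (u v : TangentSpace (𝓡 3) x) : coord x (u + v) = coord x u + coord x v :=
  map_add (mfderiv (𝓡 3) (𝓡 3) (extChartAt (𝓡 3) x) x) u v

lemma coord_smul (x : M) (c : ℝ) (u : TangentSpace (𝓡 3) x) : coord x (c • u) = c • coord x u :=
  map_smul (mfderiv (𝓡 3) (𝓡 3) (extChartAt (𝓡 3) x) x) c u

lemma finrank_tangentSpace (x : M) : finrank ℝ (TangentSpace (𝓡 3) x) = 3 :=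
  finrank_euclideanSpace_fin (𝕜 := ℝ) (n := 3)

/-- The second fundamental form at `x` with respect to the normal vector `n`, as a bilinear form on
the tangent space. -/
def tangentForm (f : M → E 4) (x : M) (n : E 4) : LinearMap.BilinForm ℝ (TangentSpace (𝓡 3) x) :=
  LinearMap.mk₂ ℝ (fun u v ↦ ⟪fderiv ℝ (fderiv ℝ (param f x)) (extChartAt (𝓡 3) x x)
    (coord x u) (coord x v), n⟫)
    (fun u v w ↦ by simp [coord_add, inner_add_left])
    (fun c u w ↦ by simp [coord_smul, inner_smul_left])
    (fun u v w ↦ by simp [coord_add, inner_add_left])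
    (fun c u w ↦ by simp [coord_smul, inner_smul_left])

lemma tangentForm_apply (f : M → E 4) (x : M) (n : E 4) (u v : TangentSpace (𝓡 3) x) :
    tangentForm f x n u v =
      ⟪fderiv ℝ (fderiv ℝ (param f x)) (extChartAt (𝓡 3) x x) (coord x u) (coord x v), n⟫ := rfl

lemma tangentForm_symm {f : M → E 4} {x : M} {Ω : Set (E 3)} {N : E 3 → E 4}
    (h : Framed Ω (param f x) N) (hx : extChartAt (𝓡 3) x x ∈ Ω) (n : E 4)
    (u v : TangentSpace (𝓡 3) x) : tangentForm f x n u v = tangentForm f x n v u := by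
  rw [tangentForm_apply, tangentForm_apply, h.snd_fderiv_symm hx]

variable [IsManifold (𝓡 3) ∞ M]

lemma contDiffOn_param {f : M → E 4} (hf : ContMDiff (𝓡 3) (𝓡 4) ∞ f) (x : M) :
    ContDiffOn ℝ ∞ (param f x) (extChartAt (𝓡 3) x).target := by
  have h1 : ContMDiffOn (𝓡 3) (𝓡 4) ∞ (param f x) (extChartAt (𝓡 3) x).target :=
    hf.comp_contMDiffOn (contMDiffOn_extChartAt_symm x)
  exact contMDiffOn_iff_contDiffOn.1 h1

lemma isManifold_one : IsManifold (𝓡 3) 1 M := IsManifold.of_le (n := ∞) (by simp)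

lemma mdifferentiableAt_symm {x : M} {y : E 3} (hy : y ∈ (extChartAt (𝓡 3) x).target) :
    MDifferentiableAt (𝓡 3) (𝓡 3) (extChartAt (𝓡 3) x).symm y := by
  have := isManifold_one (M := M)
  have h1 := mdifferentiableWithinAt_extChartAt_symm (I := 𝓡 3) hy
  rwa [ModelWithCorners.Boundaryless.range_eq_univ, mdifferentiableWithinAt_univ] at h1

lemma fderiv_param {f : M → E 4} (hf : ContMDiff (𝓡 3) (𝓡 4) ∞ f) {x : M} {y : E 3}
    (hy : y ∈ (extChartAt (𝓡 3) x).target) (u : E 3) :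
    fderiv ℝ (param f x) y u = mfderiv (𝓡 3) (𝓡 4) f ((extChartAt (𝓡 3) x).symm y)
      (mfderiv (𝓡 3) (𝓡 3) (extChartAt (𝓡 3) x).symm y u) := by
  have h1 : MDifferentiableAt (𝓡 3) (𝓡 4) f ((extChartAt (𝓡 3) x).symm y) :=
    (hf _).mdifferentiableAt (by simp)
  have h2 := mfderiv_comp y h1 (mdifferentiableAt_symm hy)
  rw [← mfderiv_eq_fderiv]
  exact DFunLike.congr_fun h2 u

lemma mfderiv_symm_injective {x : M} {y : E 3} (hy : y ∈ (extChartAt (𝓡 3) x).target) :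
    Function.Injective (mfderiv (𝓡 3) (𝓡 3) (extChartAt (𝓡 3) x).symm y) := by
  have := isManifold_one (M := M)
  have h1 := isInvertible_mfderivWithin_extChartAt_symm (I := 𝓡 3) hy
  rw [ModelWithCorners.Boundaryless.range_eq_univ, mfderivWithin_univ] at h1
  exact h1.injective

lemma coord_surjective (x : M) : Function.Surjective (coord x : TangentSpace (𝓡 3) x → E 3) := by
  have := isManifold_one (M := M)
  exact (isInvertible_mfderiv_extChartAt (I := 𝓡 3) (mem_extChartAt_source x)).surjective

lemma fderiv_param_coord {f : M → E 4} (hf : ContMDiff (𝓡 3) (𝓡 4) ∞ f) (x : M)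
    (u : TangentSpace (𝓡 3) x) :
    fderiv ℝ (param f x) (extChartAt (𝓡 3) x x) (coord x u) = mfderiv (𝓡 3) (𝓡 4) f x u := by
  have := isManifold_one (M := M)
  have h1 : f =ᶠ[nhds x] param f x ∘ extChartAt (𝓡 3) x := by
    filter_upwards [extChartAt_source_mem_nhds (I := 𝓡 3) x] with z hz
    rw [Function.comp_apply, param, Function.comp_apply, (extChartAt (𝓡 3) x).left_inv hz]
  have h2 : MDifferentiableAt (𝓡 3) (𝓡 4) (param f x) (extChartAt (𝓡 3) x x) :=
    (((contDiffOn_param hf x).contDiffAt (extChartAt_target_mem_nhds x)).differentiableAt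
      (by simp)).mdifferentiableAt
  have h3 : MDifferentiableAt (𝓡 3) (𝓡 3) (extChartAt (𝓡 3) x) x :=
    mdifferentiableAt_extChartAt (mem_chart_source _ x)
  have h4 := mfderiv_comp x h2 h3
  rw [← mfderiv_eq_fderiv]
  exact (DFunLike.congr_fun (h1.mfderiv_eq.trans h4) u).symm

variable [RiemannianBundle (fun x : M ↦ TangentSpace (𝓡 3) x)]

lemma IsIsometricImmersion.inner_fderiv_param {f : M → E 4} (hf : IsIsometricImmersion 3 f) {x : M}
    {y : E 3} (hy : y ∈ (extChartAt (𝓡 3) x).target) (u v : E 3) :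
    ⟪fderiv ℝ (param f x) y u, fderiv ℝ (param f x) y v⟫ =
      inner ℝ (mfderiv (𝓡 3) (𝓡 3) (extChartAt (𝓡 3) x).symm y u)
        (mfderiv (𝓡 3) (𝓡 3) (extChartAt (𝓡 3) x).symm y v) := by
  rw [fderiv_param hf.1 hy, fderiv_param hf.1 hy]
  exact hf.2 _ _ _

lemma IsIsometricImmersion.injective_fderiv_param {f : M → E 4} (hf : IsIsometricImmersion 3 f)
    {x : M} {y : E 3} (hy : y ∈ (extChartAt (𝓡 3) x).target) :
    Function.Injective (fderiv ℝ (param f x) y) := by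
  rw [injective_iff_map_eq_zero]
  intro u hu
  have h1 := hf.inner_fderiv_param hy u u
  rw [hu, inner_zero_left] at h1
  have h2 := inner_self_eq_zero.1 h1.symm
  exact mfderiv_symm_injective hy (h2.trans (map_zero _).symm)

lemma IsIsometricImmersion.inner_eq {f : M → E 4} (hf : IsIsometricImmersion 3 f) (x : M)
    (u v : TangentSpace (𝓡 3) x) :
    ⟪fderiv ℝ (param f x) (extChartAt (𝓡 3) x x) (coord x u),
      fderiv ℝ (param f x) (extChartAt (𝓡 3) x x) (coord x v)⟫ = inner ℝ u v := by
  rw [fderiv_param_coord hf.1, fderiv_param_coord hf.1]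
  exact hf.2 x u v

lemma IsIsometricImmersion.exists_framed {f : M → E 4} (hf : IsIsometricImmersion 3 f) {x : M}
    {y : E 3} (hy : y ∈ (extChartAt (𝓡 3) x).target) : ∃ (Ω : Set (E 3)) (N : E 3 → E 4),
      y ∈ Ω ∧ Ω ⊆ (extChartAt (𝓡 3) x).target ∧ Framed Ω (param f x) N :=
  Casorati.exists_framed (isOpen_extChartAt_target x) (contDiffOn_param hf.1 x)
    (fun _ hz ↦ hf.injective_fderiv_param hz) hy

lemma IsIsometricImmersion.metricMatrix_eq {f : M → E 4} (hf : IsIsometricImmersion 3 f) {x : M}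
    {y : E 3} (hy : y ∈ (extChartAt (𝓡 3) x).target) (i j : Fin 3) :
    metricMatrix x y i j =
      ⟪fderiv ℝ (param f x) y (stdVec i), fderiv ℝ (param f x) y (stdVec j)⟫ :=
  (hf.inner_fderiv_param hy _ _).symm

end Charts

/-! ### The Gauss equation -/

section Gauss

variable {Ω : Set (E 3)} {F N : E 3 → E 4} {y : E 3}

/-- The Christoffel form: the tangential part of the second derivative. -/
def gammaForm (F N : E 3 → E 4) (u v : E 3) (y : E 3) : E 3 :=
  tangentPart F N y (fderiv ℝ (fderiv ℝ F) y u v)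

lemma Framed.hasFDerivAt_snd_fderiv (h : Framed Ω F N) (hy : y ∈ Ω) (u v : E 3) :
    HasFDerivAt (fun z ↦ fderiv ℝ (fderiv ℝ F) z u v)
      (fderiv ℝ (fun z ↦ fderiv ℝ (fderiv ℝ F) z u v) y) y := by
  have h1 := contDiffOn_fderiv h.isOpen (contDiffOn_fderiv h.isOpen h.contDiffOn)
  exact hasFDerivAt_of_contDiffOn h.isOpen
    ((h1.clm_apply contDiffOn_const).clm_apply contDiffOn_const) hy

lemma Framed.contDiffOn_gammaForm (h : Framed Ω F N) (u v : E 3) :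
    ContDiffOn ℝ ∞ (gammaForm F N u v) Ω := by
  have h1 := contDiffOn_fderiv h.isOpen (contDiffOn_fderiv h.isOpen h.contDiffOn)
  exact h.contDiffOn_tangentPart.clm_apply
    ((h1.clm_apply contDiffOn_const).clm_apply contDiffOn_const)

lemma Framed.hasFDerivAt_gammaForm (h : Framed Ω F N) (hy : y ∈ Ω) (u v : E 3) :
    HasFDerivAt (gammaForm F N u v) (fderiv ℝ (gammaForm F N u v) y) y :=
  hasFDerivAt_of_contDiffOn h.isOpen (h.contDiffOn_gammaForm u v) hy

lemma Framed.snd_fderiv_eq (h : Framed Ω F N) (hy : y ∈ Ω) (u v : E 3) :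
    fderiv ℝ (fderiv ℝ F) y u v =
      fderiv ℝ F y (gammaForm F N u v y) + ⟪fderiv ℝ (fderiv ℝ F) y u v, N y⟫ • N y :=
  h.decompose hy _

/-- Third derivatives commute. -/
lemma Framed.third_symm (h : Framed Ω F N) (hy : y ∈ Ω) (u v w : E 3) :
    fderiv ℝ (fun z ↦ fderiv ℝ (fderiv ℝ F) z v w) y u =
      fderiv ℝ (fun z ↦ fderiv ℝ (fderiv ℝ F) z u w) y v := by
  have hd : ContDiffOn ℝ ∞ (fun z ↦ fderiv ℝ F z w) Ω :=
    (contDiffOn_fderiv h.isOpen h.contDiffOn).clm_apply contDiffOn_const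
  have key : ∀ u v, fderiv ℝ (fun z ↦ fderiv ℝ (fderiv ℝ F) z v w) y u =
      fderiv ℝ (fderiv ℝ (fun z ↦ fderiv ℝ F z w)) y u v := by
    intro u v
    have h1 := hasFDerivAt_fderiv_apply h.isOpen hd hy v
    have h2 := fderiv_unique_on h.isOpen (fun z hz ↦ by
      change _ = fderiv ℝ (fun z ↦ fderiv ℝ F z w) z v
      rw [(h.hasFDerivAt_fderiv hz w).fderiv]; rfl) hy (h.hasFDerivAt_snd_fderiv hy v w) h1
    rw [h2]; rfl
  rw [key, key, fderiv_fderiv_symm h.isOpen hd hy]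

/-- The Gauss equation, in vector form. -/
lemma Framed.gauss (h : Framed Ω F N) (hy : y ∈ Ω) (u v w z : E 3) :
    ⟪fderiv ℝ F y (fderiv ℝ (gammaForm F N v w) y u - fderiv ℝ (gammaForm F N u w) y v
      + (gammaForm F N u (gammaForm F N v w y) y - gammaForm F N v (gammaForm F N u w y) y)),
      fderiv ℝ F y z⟫ =
    ⟪fderiv ℝ (fderiv ℝ F) y u z, N y⟫ * ⟪fderiv ℝ (fderiv ℝ F) y v w, N y⟫ -
      ⟪fderiv ℝ (fderiv ℝ F) y u w, N y⟫ * ⟪fderiv ℝ (fderiv ℝ F) y v z, N y⟫ := by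
  have hF := hasFDerivAt_of_contDiffOn h.isOpen (contDiffOn_fderiv h.isOpen h.contDiffOn) hy
  have key : ∀ u v, ⟪fderiv ℝ (fun z ↦ fderiv ℝ (fderiv ℝ F) z v w) y u, fderiv ℝ F y z⟫ =
      ⟪fderiv ℝ F y (gammaForm F N u (gammaForm F N v w y) y), fderiv ℝ F y z⟫ +
      ⟪fderiv ℝ F y (fderiv ℝ (gammaForm F N v w) y u), fderiv ℝ F y z⟫ -
      ⟪fderiv ℝ (fderiv ℝ F) y v w, N y⟫ * ⟪fderiv ℝ (fderiv ℝ F) y u z, N y⟫ := by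
    intro u v
    have hb := (h.hasFDerivAt_snd_fderiv hy v w).inner ℝ (h.hasFDerivAt_normal hy)
    have h1 := (hF.clm_apply (h.hasFDerivAt_gammaForm hy v w)).add
      (hb.smul (h.hasFDerivAt_normal hy))
    have h2 := fderiv_unique_on h.isOpen (fun z hz ↦ h.snd_fderiv_eq hz v w) hy
      (h.hasFDerivAt_snd_fderiv hy v w) h1
    have h3 := DFunLike.congr_fun h2 u
    have hN : ∀ z, ⟪N y, fderiv ℝ F y z⟫ = 0 := fun z ↦ by
      rw [real_inner_comm, h.inner_normal y hy]
    -- The tangential part of `d²F(u, Γ(v, w))` is the quadratic Christoffel term. The remaining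
    -- tangential contribution comes from the derivative of `N` and becomes the product of second
    -- fundamental forms by Weingarten.
    have h4 := congrArg (fun q ↦ ⟪q, fderiv ℝ F y z⟫) (h.snd_fderiv_eq hy u (gammaForm F N v w y))
    have h5 := h.inner_snd_fderiv_normal hy u z
    rw [h3]
    simp only [inner_add_left, inner_smul_left, hN, mul_zero, add_zero] at h4
    simp [inner_add_left, inner_smul_left, hN]
    rw [h4, real_inner_comm _ (fderiv ℝ N y u), h5]
    ring
  -- Third derivatives of `F` are symmetric, so antisymmetrising `key` in `u, v` eliminates them.
  have k1 := key u v
  have k2 := key v u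
  rw [h.third_symm hy] at k1
  simp only [map_add, map_sub, inner_add_left, inner_sub_left]
  linarith

end Gauss

/-! ### Christoffel symbols and curvature of the induced metric -/

section Curvature

variable {M : Type*} [TopologicalSpace M] [ChartedSpace (E 3) M] [IsManifold (𝓡 3) ∞ M]
  [RiemannianBundle (fun x : M ↦ TangentSpace (𝓡 3) x)]
  {f : M → E 4} {x : M} {Ω : Set (E 3)} {N : E 3 → E 4} {y : E 3}

lemma sum_stdVec (u : E 3) : ∑ i, u i • stdVec i = u := by
  have := (EuclideanSpace.basisFun (Fin 3) ℝ).sum_repr u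
  simpa [stdVec] using this

lemma partialDeriv_metricMatrix (hf : IsIsometricImmersion 3 f) (h : Framed Ω (param f x) N)
    (hΩ : Ω ⊆ (extChartAt (𝓡 3) x).target) (hy : y ∈ Ω) (i j l : Fin 3) :
    partialDeriv i (fun z ↦ metricMatrix x z j l) y =
      ⟪fderiv ℝ (fderiv ℝ (param f x)) y (stdVec i) (stdVec j), fderiv ℝ (param f x) y (stdVec l)⟫ +
      ⟪fderiv ℝ (fderiv ℝ (param f x)) y (stdVec i) (stdVec l),
        fderiv ℝ (param f x) y (stdVec j)⟫ := by
  have h1 := (h.hasFDerivAt_fderiv hy (stdVec j)).inner ℝ (h.hasFDerivAt_fderiv hy (stdVec l))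
  have h2 : HasFDerivAt (fun z ↦ metricMatrix x z j l) _ y := h1.congr_of_eventuallyEq
    (Set.EqOn.eventuallyEq_of_mem (s := Ω) (fun z hz ↦ hf.metricMatrix_eq (hΩ hz) j l)
      (h.isOpen.mem_nhds hy))
  rw [partialDeriv, h2.fderiv]
  simp [add_comm, real_inner_comm]

/-- Derivatives of the metric are sums of products `⟪d²F, dF⟫`. The combination in the Christoffel
symbol collapses to twice one such product, which is the metric applied to the tangential part of
`d²F`; the inverse metric then recovers that part. -/
lemma christoffel_eq (hf : IsIsometricImmersion 3 f) (h : Framed Ω (param f x) N)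
    (hΩ : Ω ⊆ (extChartAt (𝓡 3) x).target) (hy : y ∈ Ω) (k i j : Fin 3) :
    christoffel x k i j y = gammaForm (param f x) N (stdVec i) (stdVec j) y k := by
  set F := param f x
  have hg : ∀ c : Fin 3 → ℝ, ∀ l, (metricMatrix x y).mulVec c l =
      ⟪fderiv ℝ F y (∑ m, c m • stdVec m), fderiv ℝ F y (stdVec l)⟫ := by
    intro c l
    simp only [Matrix.mulVec, dotProduct, map_sum, map_smul, sum_inner, inner_smul_left]
    refine Finset.sum_congr rfl fun m _ ↦ ?_
    rw [hf.metricMatrix_eq (hΩ hy), real_inner_comm]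
    simp [mul_comm, F]
  -- A Gram matrix of independent vectors: a vector in its kernel gives a tangent vector orthogonal
  -- to all coordinate fields, hence to itself.
  have hunit : IsUnit (metricMatrix x y) := by
    rw [← Matrix.mulVec_injective_iff_isUnit]
    rw [← Matrix.coe_mulVecLin, injective_iff_map_eq_zero]
    intro c hc
    set v : E 3 := ∑ m, c m • stdVec m with hv
    have h1 : ∀ l, ⟪fderiv ℝ F y v, fderiv ℝ F y (stdVec l)⟫ = 0 := fun l ↦ by
      rw [← hg]; exact congrFun hc l
    have h2 : ⟪fderiv ℝ F y v, fderiv ℝ F y v⟫ = 0 := by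
      conv_lhs => arg 2; rw [hv, map_sum]
      rw [sum_inner]
      exact Finset.sum_eq_zero fun m _ ↦ by
        rw [map_smul, inner_smul_left, real_inner_comm, h1, mul_zero]
    have h3 : v = 0 := by
      by_contra h0
      exact (h.norm_fderiv_pos hy h0).ne' h2
    funext m
    have h4 := congrArg (fun w : E 3 ↦ w m) h3
    simpa [hv, stdVec, Pi.single_apply] using h4
  set γ := gammaForm F N (stdVec i) (stdVec j) y with hγ
  have h1 : ∀ l, ⟪fderiv ℝ (fderiv ℝ F) y (stdVec i) (stdVec j), fderiv ℝ F y (stdVec l)⟫ =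
      (metricMatrix x y).mulVec γ l := by
    intro l
    rw [hg, sum_stdVec, h.snd_fderiv_eq hy, inner_add_left, inner_smul_left,
      real_inner_comm _ (N y), h.inner_normal y hy, mul_zero, add_zero]
  have h2 : christoffel x k i j y = ((metricMatrix x y)⁻¹.mulVec
      ((metricMatrix x y).mulVec γ)) k := by
    rw [christoffel, Matrix.mulVec, dotProduct, Finset.mul_sum]
    refine Finset.sum_congr rfl fun l _ ↦ ?_
    rw [partialDeriv_metricMatrix hf h hΩ hy, partialDeriv_metricMatrix hf h hΩ hy,
      partialDeriv_metricMatrix hf h hΩ hy, ← h1, h.snd_fderiv_symm hy (stdVec j) (stdVec i),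
      h.snd_fderiv_symm hy (stdVec l) (stdVec i), h.snd_fderiv_symm hy (stdVec l) (stdVec j)]
    ring
  rw [h2, Matrix.mulVec_mulVec, Matrix.nonsing_inv_mul _ ((Matrix.isUnit_iff_isUnit_det _).1 hunit),
    Matrix.one_mulVec]

lemma partialDeriv_christoffel (hf : IsIsometricImmersion 3 f) (h : Framed Ω (param f x) N)
    (hΩ : Ω ⊆ (extChartAt (𝓡 3) x).target) (hy : y ∈ Ω) (k i l j : Fin 3) :
    partialDeriv k (christoffel x i l j) y =
      fderiv ℝ (gammaForm (param f x) N (stdVec l) (stdVec j)) y (stdVec k) i := by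
  have h1 := h.hasFDerivAt_gammaForm hy (stdVec l) (stdVec j)
  have h2 := (EuclideanSpace.proj (𝕜 := ℝ) i : E 3 →L[ℝ] ℝ).hasFDerivAt.comp y h1
  have h3 := h2.congr_of_eventuallyEq (f₁ := christoffel x i l j)
    (Set.EqOn.eventuallyEq_of_mem (s := Ω) (fun z hz ↦ christoffel_eq hf h hΩ hz i l j)
      (h.isOpen.mem_nhds hy))
  rw [partialDeriv, h3.fderiv]
  rfl

lemma gammaForm_sum (F : E 3 → E 4) (u v : E 3) :
    gammaForm F N u v y = ∑ m, v m • gammaForm F N u (stdVec m) y := by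
  conv_lhs => rw [← sum_stdVec v]
  simp [gammaForm]

/-- The Gauss equation for hypersurfaces of Euclidean space. -/
theorem curvatureTensor_eq (hf : IsIsometricImmersion 3 f) (h : Framed Ω (param f x) N)
    (hΩ : Ω ⊆ (extChartAt (𝓡 3) x).target) (hx : extChartAt (𝓡 3) x x ∈ Ω)
    (u v w z : TangentSpace (𝓡 3) x) (B : E 3 → E 3 → ℝ)
    (hB : ∀ u v, B u v = ⟪fderiv ℝ (fderiv ℝ (param f x)) (extChartAt (𝓡 3) x x) u v,
      N (extChartAt (𝓡 3) x x)⟫) :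
    curvatureTensor x u v w z = B (coord x u) (coord x z) * B (coord x v) (coord x w) -
      B (coord x u) (coord x w) * B (coord x v) (coord x z) := by
  set p := extChartAt (𝓡 3) x x with hp
  set F := param f x with hF
  let G := gammaForm F N
  have hcoeff : ∀ i j k l, curvatureCoeff x i j k l =
      (fderiv ℝ (G (stdVec l) (stdVec j)) p (stdVec k)
        - fderiv ℝ (G (stdVec k) (stdVec j)) p (stdVec l)
        + (G (stdVec k) (G (stdVec l) (stdVec j) p) p
          - G (stdVec l) (G (stdVec k) (stdVec j) p) p)) i := by
    intro i j k l
    simp only [curvatureCoeff, ← hp, partialDeriv_christoffel hf h hΩ hx,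
      christoffel_eq hf h hΩ hx]
    simp only [G, gammaForm_sum F (stdVec k) (gammaForm F N (stdVec l) (stdVec j) p),
      gammaForm_sum F (stdVec l) (gammaForm F N (stdVec k) (stdVec j) p)]
    simp [Finset.sum_sub_distrib, mul_comm, hF]
  have hm : ∀ j k l m, ∑ i, metricMatrix x p m i * curvatureCoeff x i j k l =
      B (stdVec k) (stdVec m) * B (stdVec l) (stdVec j) -
      B (stdVec k) (stdVec j) * B (stdVec l) (stdVec m) := by
    intro j k l m
    simp only [hB]
    rw [← h.gauss hx]
    simp only [hcoeff]
    set r := fderiv ℝ (G (stdVec l) (stdVec j)) p (stdVec k)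
        - fderiv ℝ (G (stdVec k) (stdVec j)) p (stdVec l)
        + (G (stdVec k) (G (stdVec l) (stdVec j) p) p
          - G (stdVec l) (G (stdVec k) (stdVec j) p) p) with hr
    change _ = ⟪fderiv ℝ F p r, _⟫
    conv_rhs => rw [← sum_stdVec r, map_sum, sum_inner]
    refine Finset.sum_congr rfl fun i _ ↦ ?_
    rw [hf.metricMatrix_eq (hΩ hx), map_smul, inner_smul_left, real_inner_comm]
    simp [mul_comm, F]
  -- Both sides are multilinear, so after expanding in coordinates it suffices to know the
  -- contraction `hm` on coordinate vectors.
  have hBs : ∀ a b : E 3, B a b = ∑ i, ∑ j, a i * b j * B (stdVec i) (stdVec j) := by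
    intro a b
    simp only [hB]
    conv_lhs => rw [← sum_stdVec a, ← sum_stdVec b]
    simp [sum_inner, inner_smul_left, Finset.mul_sum]
    rw [Finset.sum_comm]
    exact Finset.sum_congr rfl fun i _ ↦ Finset.sum_congr rfl fun j _ ↦ by ring
  have hsum : curvatureTensor x u v w z = ∑ j, ∑ k, ∑ l, ∑ m,
      (∑ i, metricMatrix x p m i * curvatureCoeff x i j k l) *
        coord x z m * coord x w j * coord x u k * coord x v l := by
    rw [curvatureTensor, Finset.sum_comm]
    refine Finset.sum_congr rfl fun j _ ↦ ?_
    rw [Finset.sum_comm]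
    refine Finset.sum_congr rfl fun k _ ↦ ?_
    rw [Finset.sum_comm]
    refine Finset.sum_congr rfl fun l _ ↦ ?_
    rw [Finset.sum_comm]
    refine Finset.sum_congr rfl fun m _ ↦ ?_
    simp only [Finset.sum_mul, ← hp]
  rw [hsum]
  simp only [hm]
  rw [hBs (coord x u) (coord x z), hBs (coord x v) (coord x w), hBs (coord x u) (coord x w),
    hBs (coord x v) (coord x z)]
  simp only [Fin.sum_univ_three]
  ring

end Curvature

/-! ### The second fundamental form of an ideal immersion -/

section Pointwise

variable {M : Type*} [TopologicalSpace M] [ChartedSpace (E 3) M]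
  {f f' : M → E 4} {x : M} {Ω : Set (E 3)} {N N' : E 3 → E 4}

lemma secondFundamentalForm_eq (h : Framed Ω (param f x) N) (hx : extChartAt (𝓡 3) x x ∈ Ω)
    (u v : TangentSpace (𝓡 3) x) : secondFundamentalForm f x u v =
      tangentForm f x (N (extChartAt (𝓡 3) x x)) u v • N (extChartAt (𝓡 3) x x) := by
  rw [tangentForm_apply]
  set p := extChartAt (𝓡 3) x x with hp
  set w := fderiv ℝ (fderiv ℝ (param f x)) p (coord x u) (coord x v) with hw
  change (LinearMap.range (fderiv ℝ (param f x) p : E 3 →ₗ[ℝ] E 4))ᗮ.starProjection w = _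
  refine Submodule.eq_starProjection_of_mem_of_inner_eq_zero ?_ ?_
  · refine Submodule.smul_mem _ _ ?_
    rintro _ ⟨z, rfl⟩
    exact h.inner_normal p hx z
  · intro z hz
    have h1 := h.decompose hx w
    have h2 : w - ⟪w, N p⟫ • N p = fderiv ℝ (param f x) p (tangentPart (param f x) N p w) := by
      rw [sub_eq_iff_eq_add]; exact h1
    rw [h2]
    exact hz _ ⟨_, rfl⟩

lemma norm_secondFundamentalForm_sq (h : Framed Ω (param f x) N) (hx : extChartAt (𝓡 3) x x ∈ Ω)
    (u v : TangentSpace (𝓡 3) x) : ‖secondFundamentalForm f x u v‖ ^ 2 =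
      tangentForm f x (N (extChartAt (𝓡 3) x x)) u v ^ 2 := by
  rw [secondFundamentalForm_eq h hx, norm_smul, h.norm_normal _ hx, mul_one, Real.norm_eq_abs,
    sq_abs]

variable [IsManifold (𝓡 3) ∞ M]

lemma isFlatAt_iff_secondFundamentalForm (h : Framed Ω (param f x) N)
    (hx : extChartAt (𝓡 3) x x ∈ Ω) :
    IsFlatAt (param f x) (extChartAt (𝓡 3) x x) ↔
      ∀ u v : TangentSpace (𝓡 3) x, secondFundamentalForm f x u v = 0 := by
  constructor
  · intro hfl u v
    rw [secondFundamentalForm_eq h hx, tangentForm_apply, hfl _ (h.inner_normal _ hx), zero_smul]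
  · intro h0 n hn u v
    obtain ⟨u, rfl⟩ := coord_surjective x u
    obtain ⟨v, rfl⟩ := coord_surjective x v
    have h1 := h0 u v
    rw [secondFundamentalForm_eq h hx, tangentForm_apply] at h1
    have hN : N (extChartAt (𝓡 3) x x) ≠ 0 := fun h2 ↦ by
      have h3 := h.norm_normal _ hx
      rw [h2, norm_zero] at h3
      exact zero_ne_one h3
    have h2 := (smul_eq_zero.1 h1).resolve_right hN
    have h3 := h.decompose hx n
    have h4 : fderiv ℝ (param f x) (extChartAt (𝓡 3) x x)
        (tangentPart (param f x) N (extChartAt (𝓡 3) x x) n) = 0 := by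
      set t := fderiv ℝ (param f x) (extChartAt (𝓡 3) x x)
        (tangentPart (param f x) N (extChartAt (𝓡 3) x x) n) with ht
      have h5 : ⟪t, n⟫ = 0 := hn _
      have h6 : ⟪t, N (extChartAt (𝓡 3) x x)⟫ = 0 := h.inner_normal _ hx _
      rw [h3, inner_add_right, inner_smul_right, h6, mul_zero, add_zero] at h5
      exact inner_self_eq_zero.1 h5
    rw [h4, zero_add] at h3
    rw [h3, inner_smul_right]
    exact mul_eq_zero_of_right _ h2

variable [RiemannianBundle (fun x : M ↦ TangentSpace (𝓡 3) x)]

/-- By Gauss, the sectional curvatures are principal 2×2 minors; twice their sum over `i < j` is the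
squared trace minus the squared norm. -/
lemma normalizedScalarCurvature_eq (hf : IsIsometricImmersion 3 f) (h : Framed Ω (param f x) N)
    (hΩ : Ω ⊆ (extChartAt (𝓡 3) x).target) (hx : extChartAt (𝓡 3) x x ∈ Ω) {t s : ℝ}
    (hts : ∀ {ι : Type} [Fintype ι] (e : OrthonormalBasis ι ℝ (TangentSpace (𝓡 3) x)),
      ∑ i, tangentForm f x (N (extChartAt (𝓡 3) x x)) (e i) (e i) = t ∧
      ∑ i, ∑ j, tangentForm f x (N (extChartAt (𝓡 3) x x)) (e i) (e j) ^ 2 = s) :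
    normalizedScalarCurvature 3 x = (t ^ 2 - s) / 6 := by
  set B := tangentForm f x (N (extChartAt (𝓡 3) x x)) with hB
  set e := stdOrthonormalBasis ℝ (TangentSpace (𝓡 3) x) with he
  have hsec : ∀ i j, i < j → sectionalCurvature x (e i) (e j) =
      B (e i) (e i) * B (e j) (e j) - B (e i) (e j) ^ 2 := by
    intro i j hij
    have o := orthonormal_iff_ite.1 e.orthonormal
    rw [sectionalCurvature, o, o, o, if_pos rfl, if_pos rfl, if_neg hij.ne,
      curvatureTensor_eq hf h hΩ hx _ _ _ _ _ (fun _ _ ↦ rfl)]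
    simp only [hB, tangentForm_apply]
    rw [h.snd_fderiv_symm hx (coord x (e j)) (coord x (e i))]
    ring
  have h1 : scalarCurvature 3 x = (1 / 2) * (t ^ 2 - s) := by
    have h2 : scalarCurvature 3 x = ∑ i, ∑ j, if i < j then
        (B (e i) (e i) * B (e j) (e j) - B (e i) (e j) ^ 2) else 0 := by
      rw [scalarCurvature]
      refine Finset.sum_congr rfl fun i _ ↦ Finset.sum_congr rfl fun j _ ↦ ?_
      split_ifs with hij
      · exact hsec i j hij
      · rfl
    rw [h2, sum_lt_eq_half _ (fun i j ↦ by rw [tangentForm_symm h hx _ (e i) (e j)]; ring)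
      (fun i ↦ by ring)]
    simp only [Finset.sum_sub_distrib]
    rw [(hts e).2, ← (hts e).1, sq, Finset.sum_mul_sum]
  rw [normalizedScalarCurvature, h1]
  push_cast
  ring

lemma exists_form_of_ideal (hf : IsIsometricImmersion 3 f) (hid : IsCasoratiIdeal 3 f)
    (h : Framed Ω (param f x) N) (hΩ : Ω ⊆ (extChartAt (𝓡 3) x).target)
    (hx : extChartAt (𝓡 3) x x ∈ Ω) :
    ∃ (ξ : TangentSpace (𝓡 3) x) (a : ℝ), ‖ξ‖ = 1 ∧
      ∀ u v, tangentForm f x (N (extChartAt (𝓡 3) x x)) u v =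
        a * (inner ℝ u v + inner ℝ u ξ * inner ℝ v ξ) := by
  obtain ⟨t, s, hts⟩ := exists_traces (tangentForm f x (N (extChartAt (𝓡 3) x x)))
    (tangentForm_symm h hx _)
  refine exists_eq_of_casorati_ideal (finrank_tangentSpace x) _ (tangentForm_symm h hx _)
    (fun e ↦ hts e) ?_
  have h1 := hid x
  rw [normalizedScalarCurvature_eq hf h hΩ hx hts] at h1
  rw [h1, deltaCasorati, casoratiCurvature]
  simp only [norm_secondFundamentalForm_sq h hx, (hts (stdOrthonormalBasis ℝ _)).2,
    casoratiCurvatureOn]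
  norm_num

/-- The form on the abstract tangent space is transported to the chart through `coord`, which
identifies the two inner products via `df`. -/
lemma hasIdealForm_param (hf : IsIsometricImmersion 3 f) (hid : IsCasoratiIdeal 3 f) (x : M) :
    HasIdealForm (param f x) (extChartAt (𝓡 3) x x) := by
  obtain ⟨Ω, N, hx, hΩ, h⟩ := hf.exists_framed (mem_extChartAt_target (I := 𝓡 3) x)
  obtain ⟨ξ, a, hξ, hform⟩ := exists_form_of_ideal hf hid h hΩ hx
  refine ⟨N (extChartAt (𝓡 3) x x), fderiv ℝ (param f x) (extChartAt (𝓡 3) x x) (coord x ξ), a,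
    h.norm_normal _ hx, h.inner_normal _ hx, ?_, h.inner_normal _ hx _, fun u v ↦ ?_⟩
  · have h1 := hf.inner_eq x ξ ξ
    rw [real_inner_self_eq_norm_sq, real_inner_self_eq_norm_sq, hξ, one_pow] at h1
    exact (pow_eq_one_iff_of_nonneg (norm_nonneg _) two_ne_zero).1 h1
  · obtain ⟨u, rfl⟩ := coord_surjective x u
    obtain ⟨v, rfl⟩ := coord_surjective x v
    rw [hf.inner_eq x u v, hf.inner_eq x u ξ, hf.inner_eq x v ξ]
    exact hform u v

/-- Both immersions have the curvature tensor of `M`, so algebraic rigidity applies. Nonflatness is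
what makes `a ≠ 0` there. -/
lemma sameForm_param (hf : IsIsometricImmersion 3 f) (hf' : IsIsometricImmersion 3 f')
    (hid : IsCasoratiIdeal 3 f) (x : M)
    (hfl : ¬ IsFlatAt (param f x) (extChartAt (𝓡 3) x x)) :
    SameForm (param f x) (param f' x) (extChartAt (𝓡 3) x x) := by
  obtain ⟨Ω, N, hx, hΩ, h⟩ := hf.exists_framed (mem_extChartAt_target (I := 𝓡 3) x)
  obtain ⟨Ω', N', hx', hΩ', h'⟩ := hf'.exists_framed (mem_extChartAt_target (I := 𝓡 3) x)
  obtain ⟨ξ, a, hξ, hform⟩ := exists_form_of_ideal hf hid h hΩ hx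
  have ha : a ≠ 0 := by
    rintro rfl
    refine hfl ((isFlatAt_iff_secondFundamentalForm h hx).2 fun u v ↦ ?_)
    rw [secondFundamentalForm_eq h hx, hform]
    simp
  rcases eq_or_eq_neg_of_same_curvature (finrank_tangentSpace x) _
    (tangentForm f' x (N' (extChartAt (𝓡 3) x x))) (tangentForm_symm h' hx' _) ha hξ hform
    (fun u v w z ↦ (curvatureTensor_eq hf h hΩ hx u v w z _ (fun _ _ ↦ rfl)).symm.trans
      (curvatureTensor_eq hf' h' hΩ' hx' u v w z _ (fun _ _ ↦ rfl))) with hs | hs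
  · refine ⟨N _, N' _, h.norm_normal _ hx, h.inner_normal _ hx, h'.norm_normal _ hx',
      h'.inner_normal _ hx', fun u v ↦ ?_⟩
    obtain ⟨u, rfl⟩ := coord_surjective x u
    obtain ⟨v, rfl⟩ := coord_surjective x v
    exact (hs u v).symm
  · refine ⟨N _, -N' (extChartAt (𝓡 3) x x), h.norm_normal _ hx,
      h.inner_normal _ hx, ?_, fun u ↦ ?_, fun u v ↦ ?_⟩
    · rw [norm_neg]; exact h'.norm_normal _ hx'
    · rw [inner_neg_right, h'.inner_normal _ hx', neg_zero]
    · obtain ⟨u, rfl⟩ := coord_surjective x u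
      obtain ⟨v, rfl⟩ := coord_surjective x v
      rw [inner_neg_right]
      exact (neg_eq_iff_eq_neg.2 (hs u v)).symm

end Pointwise

/-! ### Change of charts and global rigidity -/

section Reparametrization

variable {F F₀ G G₀ : E 3 → E 4} {τ : E 3 → E 3} {y : E 3}

lemma fderiv_reparam (hF₀ : ContDiffAt ℝ ∞ F₀ (τ y)) (hτ : ContDiffAt ℝ ∞ τ y)
    (h : F =ᶠ[nhds y] F₀ ∘ τ) (u : E 3) : fderiv ℝ F y u = fderiv ℝ F₀ (τ y) (fderiv ℝ τ y u) := by
  rw [h.fderiv_eq, fderiv_comp y (hF₀.differentiableAt (by simp)) (hτ.differentiableAt (by simp))]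
  rfl

lemma snd_fderiv_reparam (hF₀ : ContDiffAt ℝ ∞ F₀ (τ y)) (hτ : ContDiffAt ℝ ∞ τ y)
    (h : F =ᶠ[nhds y] F₀ ∘ τ) (u v : E 3) : fderiv ℝ (fderiv ℝ F) y u v =
      fderiv ℝ (fderiv ℝ F₀) (τ y) (fderiv ℝ τ y u) (fderiv ℝ τ y v) +
        fderiv ℝ F₀ (τ y) (fderiv ℝ (fderiv ℝ τ) y u v) := by
  have h1 : fderiv ℝ F =ᶠ[nhds y] fun z ↦ (fderiv ℝ F₀ (τ z)).comp (fderiv ℝ τ z) := by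
    have h2 : ContDiffAt ℝ 1 F₀ (τ y) := hF₀.of_le (by simp)
    have h3 : ContDiffAt ℝ 1 τ y := hτ.of_le (by simp)
    filter_upwards [h.eventuallyEq_nhds, h3.eventually (by simp),
      h3.continuousAt.eventually (h2.eventually (by simp))] with z hz hz1 hz2
    rw [hz.fderiv_eq, fderiv_comp z (hz2.differentiableAt (by simp))
      (hz1.differentiableAt (by simp))]
  have h2 : HasFDerivAt (fderiv ℝ F₀) (fderiv ℝ (fderiv ℝ F₀) (τ y)) (τ y) :=
    ((hF₀.fderiv_right (m := ∞) (by simp)).differentiableAt (by simp)).hasFDerivAt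
  have h3 : HasFDerivAt (fderiv ℝ τ) (fderiv ℝ (fderiv ℝ τ) y) y :=
    ((hτ.fderiv_right (m := ∞) (by simp)).differentiableAt (by simp)).hasFDerivAt
  have h4 := (h2.comp y (hτ.differentiableAt (by simp)).hasFDerivAt).clm_comp h3
  have h5 := DFunLike.congr_fun (DFunLike.congr_fun (h4.congr_of_eventuallyEq h1).fderiv u) v
  rw [h5, add_comm]
  rfl

/-- The second derivative of the coordinate change contributes only a tangential vector, which a
normal does not see. This makes the pointwise conditions independent of the chart. -/
lemma inner_snd_fderiv_reparam (hF₀ : ContDiffAt ℝ ∞ F₀ (τ y)) (hτ : ContDiffAt ℝ ∞ τ y)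
    (h : F =ᶠ[nhds y] F₀ ∘ τ) {n : E 4} (hn : ∀ u, ⟪fderiv ℝ F₀ (τ y) u, n⟫ = 0) (u v : E 3) :
    ⟪fderiv ℝ (fderiv ℝ F) y u v, n⟫ =
      ⟪fderiv ℝ (fderiv ℝ F₀) (τ y) (fderiv ℝ τ y u) (fderiv ℝ τ y v), n⟫ := by
  rw [snd_fderiv_reparam hF₀ hτ h, inner_add_left, hn, add_zero]

lemma HasIdealForm.reparam (hid : HasIdealForm F₀ (τ y)) (hF₀ : ContDiffAt ℝ ∞ F₀ (τ y))
    (hτ : ContDiffAt ℝ ∞ τ y) (h : F =ᶠ[nhds y] F₀ ∘ τ) : HasIdealForm F y := by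
  obtain ⟨n, T, a, hn, hn', hT, hTn, hform⟩ := hid
  refine ⟨n, T, a, hn, fun u ↦ ?_, hT, hTn, fun u v ↦ ?_⟩
  · rw [fderiv_reparam hF₀ hτ h, hn']
  · rw [inner_snd_fderiv_reparam hF₀ hτ h hn', hform, fderiv_reparam hF₀ hτ h,
      fderiv_reparam hF₀ hτ h]

lemma SameForm.reparam (hs : SameForm F₀ G₀ (τ y)) (hF₀ : ContDiffAt ℝ ∞ F₀ (τ y))
    (hG₀ : ContDiffAt ℝ ∞ G₀ (τ y)) (hτ : ContDiffAt ℝ ∞ τ y) (h : F =ᶠ[nhds y] F₀ ∘ τ)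
    (h' : G =ᶠ[nhds y] G₀ ∘ τ) : SameForm F G y := by
  obtain ⟨n, n', h1, h2, h3, h4, h5⟩ := hs
  refine ⟨n, n', h1, fun u ↦ ?_, h3, fun u ↦ ?_, fun u v ↦ ?_⟩
  · rw [fderiv_reparam hF₀ hτ h, h2]
  · rw [fderiv_reparam hG₀ hτ h', h4]
  · rw [inner_snd_fderiv_reparam hF₀ hτ h h2, inner_snd_fderiv_reparam hG₀ hτ h' h4, h5]

lemma IsFlatAt.reparam (hfl : IsFlatAt F₀ (τ y)) (hF₀ : ContDiffAt ℝ ∞ F₀ (τ y))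
    (hτ : ContDiffAt ℝ ∞ τ y) (h : F =ᶠ[nhds y] F₀ ∘ τ)
    (hinj : Function.Injective (fderiv ℝ F y)) : IsFlatAt F y := by
  -- Invertibility of `dτ` is needed because flatness quantifies over all normals: a normal of `F`
  -- must be shown to be one of `F₀`.
  have h1 : Function.Injective (fderiv ℝ τ y).toLinearMap := fun u v huv ↦ hinj (by
    rw [fderiv_reparam hF₀ hτ h, fderiv_reparam hF₀ hτ h]
    exact congrArg _ huv)
  have h2 := LinearMap.injective_iff_surjective.1 h1
  intro n hn u v
  have h3 : ∀ w, ⟪fderiv ℝ F₀ (τ y) w, n⟫ = 0 := fun w ↦ by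
    obtain ⟨w, rfl⟩ := h2 w
    have h4 := hn w
    rwa [fderiv_reparam hF₀ hτ h] at h4
  rw [inner_snd_fderiv_reparam hF₀ hτ h h3, hfl n h3]

/-- A rigid motion is determined by its values on a piece of a hypersurface that is not flat. -/
lemma Framed.isometry_unique {Ω : Set (E 3)} {N : E 3 → E 4} (hF : Framed Ω F N) (hy : y ∈ Ω)
    (hid : HasIdealForm F y) (hfl : ¬ IsFlatAt F y) {O O' : E 4 ≃ₗᵢ[ℝ] E 4} {c c' : E 4}
    (h : ∀ᶠ z in nhds y, O (F z) + c = O' (F z) + c') : O = O' ∧ c = c' := by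
  let D : E 4 →L[ℝ] E 4 := (O : E 4 →L[ℝ] E 4) - (O' : E 4 →L[ℝ] E 4)
  have hD : ∀ w, D w = O w - O' w := fun w ↦ rfl
  have h1 : (fun z ↦ D (F z)) =ᶠ[nhds y] fun _ ↦ c' - c := by
    filter_upwards [h] with z hz
    rw [hD, sub_eq_sub_iff_add_eq_add, add_comm c', hz]
  have h2 : ∀ u, (fun z ↦ D (fderiv ℝ F z u)) =ᶠ[nhds y] fun _ ↦ 0 := fun u ↦ by
    filter_upwards [h1.eventuallyEq_nhds, hF.isOpen.mem_nhds hy] with z hz hzΩ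
    have h3 := (D.hasFDerivAt.comp z (hF.hasFDerivAt hzΩ)).unique
      ((hasFDerivAt_const _ _).congr_of_eventuallyEq hz)
    exact DFunLike.congr_fun h3 u
  have h3 : ∀ u v, D (fderiv ℝ (fderiv ℝ F) y u v) = 0 := fun u v ↦ by
    have h4 := (D.hasFDerivAt.comp y (hF.hasFDerivAt_fderiv hy v)).unique
      ((hasFDerivAt_const _ _).congr_of_eventuallyEq (h2 v))
    simpa using DFunLike.congr_fun h4 u
  have h4 : ∀ u, D (fderiv ℝ F y u) = 0 := fun u ↦ (h2 u).eq_of_nhds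
  obtain ⟨w, hw⟩ := exists_ne (0 : E 3)
  obtain ⟨T, hT⟩ := hid.isPrincipal hF hy
  have hne := hT.inner_snd_fderiv_ne_zero hF hy
    (fun h0 ↦ hfl ((hT.isFlatAt_iff hF hy).2 h0)) hw
  -- `D` kills tangent vectors and `d²F(w, w)`, whose normal component is nonzero by definiteness.
  -- It therefore kills the normal, hence everything.
  have hN : D (N y) = 0 := by
    have h5 := h3 w w
    rw [hF.decompose hy (fderiv ℝ (fderiv ℝ F) y w w), map_add, h4, zero_add, map_smul] at h5
    exact (smul_eq_zero.1 h5).resolve_left hne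
  have hO : O = O' := by
    ext1 v
    have h5 : D v = 0 := by
      rw [hF.decompose hy v, map_add, h4, map_smul, hN, smul_zero, zero_add]
    exact sub_eq_zero.1 h5
  refine ⟨hO, ?_⟩
  have h5 := h.self_of_nhds
  rw [hO] at h5
  exact add_left_cancel h5

end Reparametrization

/-! ### Passage from charts to the whole manifold -/

section Global

variable {M : Type*} [TopologicalSpace M] [ChartedSpace (E 3) M]

lemma exists_chart_ball {Ω : Set (E 3)} {x : M} (hΩ : IsOpen Ω) (hx : extChartAt (𝓡 3) x x ∈ Ω) :
    ∃ r > 0, Metric.ball (extChartAt (𝓡 3) x x) r ⊆ Ω ∧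
      ∀ᶠ z in nhds x, z ∈ (extChartAt (𝓡 3) x).source ∧
        extChartAt (𝓡 3) x z ∈ Metric.ball (extChartAt (𝓡 3) x x) r := by
  obtain ⟨r, hr, hball⟩ := Metric.isOpen_iff.1 hΩ _ hx
  exact ⟨r, hr, hball, Filter.Eventually.and (extChartAt_source_mem_nhds x)
    (continuousAt_extChartAt x (Metric.ball_mem_nhds _ hr))⟩

variable [IsManifold (𝓡 3) ∞ M]

lemma exists_transition {x x' z : M} (hz : z ∈ (extChartAt (𝓡 3) x).source)
    (hz' : z ∈ (extChartAt (𝓡 3) x').source) :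
    ∃ τ : E 3 → E 3, ContDiffAt ℝ ∞ τ (extChartAt (𝓡 3) x z) ∧
      τ (extChartAt (𝓡 3) x z) = extChartAt (𝓡 3) x' z ∧
      ∀ f : M → E 4, param f x =ᶠ[nhds (extChartAt (𝓡 3) x z)] param f x' ∘ τ := by
  refine ⟨extChartAt (𝓡 3) x' ∘ (extChartAt (𝓡 3) x).symm, ?_, ?_, fun f ↦ ?_⟩
  · have h1 := contDiffWithinAt_ext_coord_change (I := 𝓡 3) (n := ∞) x' x
      (y := extChartAt (𝓡 3) x z) (by
        rw [PartialEquiv.trans_source, PartialEquiv.symm_source]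
        exact ⟨(extChartAt (𝓡 3) x).map_source hz, by
          rwa [Set.mem_preimage, (extChartAt (𝓡 3) x).left_inv hz]⟩)
    rwa [ModelWithCorners.Boundaryless.range_eq_univ, contDiffWithinAt_univ] at h1
  · rw [Function.comp_apply, (extChartAt (𝓡 3) x).left_inv hz]
  · have h1 := continuousAt_extChartAt_symm' (I := 𝓡 3) hz
    have h2 : (extChartAt (𝓡 3) x').source ∈
        nhds ((extChartAt (𝓡 3) x).symm (extChartAt (𝓡 3) x z)) := by
      rw [(extChartAt (𝓡 3) x).left_inv hz]
      exact (isOpen_extChartAt_source x').mem_nhds hz'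
    filter_upwards [h1 h2] with w hw
    simp only [param, Function.comp_apply]
    rw [(extChartAt (𝓡 3) x').left_inv hw]

lemma contDiffAt_param {f : M → E 4} (hf : ContMDiff (𝓡 3) (𝓡 4) ∞ f) {x z : M}
    (hz : z ∈ (extChartAt (𝓡 3) x).source) :
    ContDiffAt ℝ ∞ (param f x) (extChartAt (𝓡 3) x z) :=
  (contDiffOn_param hf x).contDiffAt
    (extChartAt_target_mem_nhds' ((extChartAt (𝓡 3) x).map_source hz))

variable [RiemannianBundle (fun x : M ↦ TangentSpace (𝓡 3) x)] {f f' : M → E 4}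

/-- The intrinsic hypotheses are expressed at each point in the chart centred there, whereas the
local analysis needs them throughout one fixed chart. -/
lemma hasIdealForm_param_of_mem_source (hf : IsIsometricImmersion 3 f)
    (hid : IsCasoratiIdeal 3 f) {x z : M} (hz : z ∈ (extChartAt (𝓡 3) x).source) :
    HasIdealForm (param f x) (extChartAt (𝓡 3) x z) := by
  obtain ⟨τ, hτ, hτz, heq⟩ := exists_transition hz (mem_extChartAt_source (I := 𝓡 3) z)
  refine HasIdealForm.reparam ?_ ?_ hτ (heq f)
  · rw [hτz]; exact hasIdealForm_param hf hid z
  · rw [hτz]; exact contDiffAt_param hf.1 (mem_extChartAt_source z)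

lemma IsFlatAt.change_chart (hf : IsIsometricImmersion 3 f) {x x' z : M}
    (hz : z ∈ (extChartAt (𝓡 3) x).source) (hz' : z ∈ (extChartAt (𝓡 3) x').source)
    (hfl : IsFlatAt (param f x) (extChartAt (𝓡 3) x z)) :
    IsFlatAt (param f x') (extChartAt (𝓡 3) x' z) := by
  obtain ⟨τ, hτ, hτz, heq⟩ := exists_transition hz' hz
  refine IsFlatAt.reparam ?_ ?_ hτ (heq f)
    (hf.injective_fderiv_param ((extChartAt (𝓡 3) x').map_source hz'))
  · rwa [hτz]
  · rw [hτz]; exact contDiffAt_param hf.1 hz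

lemma sameForm_param_of_mem_source (hf : IsIsometricImmersion 3 f)
    (hf' : IsIsometricImmersion 3 f') (hid : IsCasoratiIdeal 3 f) {x z : M}
    (hz : z ∈ (extChartAt (𝓡 3) x).source)
    (hfl : ¬ IsFlatAt (param f x) (extChartAt (𝓡 3) x z)) :
    SameForm (param f x) (param f' x) (extChartAt (𝓡 3) x z) := by
  have hz' := mem_extChartAt_source (I := 𝓡 3) z
  obtain ⟨τ, hτ, hτz, heq⟩ := exists_transition hz hz'
  refine SameForm.reparam ?_ ?_ ?_ hτ (heq f) (heq f')
  · rw [hτz]; exact sameForm_param hf hf' hid z fun h ↦ hfl (h.change_chart hf hz' hz)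
  · rw [hτz]; exact contDiffAt_param hf.1 hz'
  · rw [hτz]; exact contDiffAt_param hf'.1 hz'

/-- Flatness propagates across a connected coordinate ball in both directions, from the centre and
to it. -/
lemma eventually_isFlatAt_iff (hf : IsIsometricImmersion 3 f) (hid : IsCasoratiIdeal 3 f) (x : M) :
    ∀ᶠ z in nhds x, IsFlatAt (param f z) (extChartAt (𝓡 3) z z) ↔
      IsFlatAt (param f x) (extChartAt (𝓡 3) x x) := by
  obtain ⟨Ω, N, hx, hΩ, h⟩ := hf.exists_framed (mem_extChartAt_target (I := 𝓡 3) x)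
  obtain ⟨r, hr, hball, hev⟩ := exists_chart_ball h.isOpen hx
  have hB := h.mono Metric.isOpen_ball hball
  have hid' : ∀ y ∈ Metric.ball (extChartAt (𝓡 3) x x) r, HasIdealForm (param f x) y := by
    intro y hy
    have hy' := hΩ (hball hy)
    have h1 := hasIdealForm_param_of_mem_source hf hid ((extChartAt (𝓡 3) x).map_target hy')
    rwa [(extChartAt (𝓡 3) x).right_inv hy'] at h1
  have hc : IsPreconnected (Metric.ball (extChartAt (𝓡 3) x x) r) :=
    (convex_ball _ _).isPreconnected
  filter_upwards [hev] with z ⟨hz, hzB⟩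
  have hz' := mem_extChartAt_source (I := 𝓡 3) z
  constructor
  · intro hfl
    exact isFlatAt_of_isFlatAt hB hid' hc hzB (hfl.change_chart hf hz' hz)
      (Metric.mem_ball_self hr)
  · intro hfl
    exact (isFlatAt_of_isFlatAt hB hid' hc (Metric.mem_ball_self hr) hfl hzB).change_chart hf hz hz'

lemma not_isFlatAt_of_not_isTotallyGeodesic [PreconnectedSpace M]
    (hf : IsIsometricImmersion 3 f) (hid : IsCasoratiIdeal 3 f) (hne : ¬ IsTotallyGeodesic 3 f)
    (x : M) : ¬ IsFlatAt (param f x) (extChartAt (𝓡 3) x x) := by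
  intro hfl
  refine hne fun z ↦ ?_
  have hloc : IsLocallyConstant fun z : M ↦ IsFlatAt (param f z) (extChartAt (𝓡 3) z z) :=
    (IsLocallyConstant.iff_eventually_eq _).2 fun x ↦
      (eventually_isFlatAt_iff hf hid x).mono fun _ h ↦ propext h
  have hz : IsFlatAt (param f z) (extChartAt (𝓡 3) z z) :=
    (hloc.apply_eq_of_preconnectedSpace x z).mp hfl
  obtain ⟨Ω, N, hx, hΩ, h⟩ := hf.exists_framed (mem_extChartAt_target (I := 𝓡 3) z)
  exact (isFlatAt_iff_secondFundamentalForm h hx).1 hz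

lemma eventually_eq_isometry (hf : IsIsometricImmersion 3 f) (hf' : IsIsometricImmersion 3 f')
    (hid : IsCasoratiIdeal 3 f)
    (hfl : ∀ x : M, ¬ IsFlatAt (param f x) (extChartAt (𝓡 3) x x)) (x : M) :
    ∃ (O : E 4 ≃ₗᵢ[ℝ] E 4) (c : E 4), ∀ᶠ z in nhds x, f' z = O (f z) + c := by
  obtain ⟨Ω, N, hx, hΩ, h⟩ := hf.exists_framed (mem_extChartAt_target (I := 𝓡 3) x)
  obtain ⟨Ω', N', hx', hΩ', h'⟩ := hf'.exists_framed (mem_extChartAt_target (I := 𝓡 3) x)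
  obtain ⟨r, hr, hball, hev⟩ := exists_chart_ball (h.isOpen.inter h'.isOpen) ⟨hx, hx'⟩
  have hsrc : ∀ y ∈ Metric.ball (extChartAt (𝓡 3) x x) r, ∃ z ∈ (extChartAt (𝓡 3) x).source,
      extChartAt (𝓡 3) x z = y := fun y hy ↦
    ⟨_, (extChartAt (𝓡 3) x).map_target (hΩ (hball hy).1),
      (extChartAt (𝓡 3) x).right_inv (hΩ (hball hy).1)⟩
  have hfl' : ∀ y ∈ Metric.ball (extChartAt (𝓡 3) x x) r, ¬ IsFlatAt (param f x) y := by
    intro y hy h0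
    obtain ⟨z, hz, rfl⟩ := hsrc y hy
    exact hfl z (h0.change_chart hf hz (mem_extChartAt_source z))
  obtain ⟨O, c, hO⟩ := exists_isometry_of_sameForm
    (h.mono Metric.isOpen_ball (hball.trans Set.inter_subset_left))
    (h'.mono Metric.isOpen_ball (hball.trans Set.inter_subset_right))
    (fun y hy ↦ by
      obtain ⟨z, hz, rfl⟩ := hsrc y hy
      exact hasIdealForm_param_of_mem_source hf hid hz) hfl'
    (fun y hy u v ↦ by
      rw [hf.inner_fderiv_param (hΩ (hball hy).1), hf'.inner_fderiv_param (hΩ (hball hy).1)])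
    (fun y hy ↦ by
      have h0 := hfl' y hy
      obtain ⟨z, hz, rfl⟩ := hsrc y hy
      exact sameForm_param_of_mem_source hf hf' hid hz h0)
    (convex_ball _ _).isPreconnected (Metric.mem_ball_self hr)
  refine ⟨O, c, hev.mono fun z ⟨hz, hzB⟩ ↦ ?_⟩
  have h1 := hO _ hzB
  simpa only [param, Function.comp_apply, (extChartAt (𝓡 3) x).left_inv hz] using h1

lemma isometry_unique (hf : IsIsometricImmersion 3 f) (hid : IsCasoratiIdeal 3 f) {x : M}
    (hfl : ¬ IsFlatAt (param f x) (extChartAt (𝓡 3) x x)) {O O' : E 4 ≃ₗᵢ[ℝ] E 4} {c c' : E 4}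
    (h : ∀ᶠ z in nhds x, O (f z) + c = O' (f z) + c') : O = O' ∧ c = c' := by
  obtain ⟨Ω, N, hx, hΩ, hF⟩ := hf.exists_framed (mem_extChartAt_target (I := 𝓡 3) x)
  refine hF.isometry_unique hx (hasIdealForm_param hf hid x) hfl ?_
  have h1 := continuousAt_extChartAt_symm (I := 𝓡 3) x
  rw [ContinuousAt, extChartAt_to_inv] at h1
  exact h1.eventually h

theorem isRigid_of_isCasoratiIdeal [ConnectedSpace M] (hf : IsIsometricImmersion 3 f)
    (hid : IsCasoratiIdeal 3 f) (hne : ¬ IsTotallyGeodesic 3 f) : IsRigid 3 f := by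
  intro f' hf'
  have hfl := not_isFlatAt_of_not_isTotallyGeodesic hf hid hne
  obtain ⟨x₀⟩ := (inferInstance : Nonempty M)
  obtain ⟨O, c, hO⟩ := eventually_eq_isometry hf hf' hid hfl x₀
  have hloc : IsLocallyConstant fun x : M ↦ ∀ᶠ z in nhds x, f' z = O (f z) + c := by
    rw [IsLocallyConstant.iff_eventually_eq]
    intro x
    obtain ⟨O', c', hO'⟩ := eventually_eq_isometry hf hf' hid hfl x
    -- Near `x` some motion `(O', c')` carries `f` to `f'`. By uniqueness at nonflat points, `(O,
    -- c)` works near `y` exactly when it is that motion, a condition that does not depend on `y`.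
    have key : ∀ y, (∀ᶠ z in nhds y, f' z = O' (f z) + c') →
        ((∀ᶠ z in nhds y, f' z = O (f z) + c) ↔ O = O' ∧ c = c') := by
      intro y hy
      constructor
      · intro hy'
        exact isometry_unique hf hid (hfl y) (by
          filter_upwards [hy, hy'] with z h1 h2
          rw [← h1, ← h2])
      · rintro ⟨rfl, rfl⟩
        exact hy
    filter_upwards [hO'.eventually_nhds] with y hy
    exact propext ((key y hy).trans (key x hO').symm)
  refine ⟨O.toIsometryEquiv.trans (IsometryEquiv.addRight c), fun x ↦ ?_⟩
  have hx : ∀ᶠ z in nhds x, f' z = O (f z) + c :=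
    (hloc.apply_eq_of_preconnectedSpace x₀ x).mp hO
  exact hx.self_of_nhds

end Global

end Casorati

end

theorem theorem5p5 {M : Type*} [TopologicalSpace M] [ConnectedSpace M]
    [ChartedSpace (Casorati.E 3) M] [IsManifold (𝓡 3) ∞ M]
    [RiemannianBundle (fun x : M ↦ TangentSpace (𝓡 3) x)]
    [IsContMDiffRiemannianBundle (𝓡 3) ∞ (Casorati.E 3) (fun x : M ↦ TangentSpace (𝓡 3) x)]
    (f : M → Casorati.E 4) (hf : Casorati.IsIsometricImmersion 3 f)
    (hideal : Casorati.IsCasoratiIdeal 3 f) (hnontrivial : ¬ Casorati.IsTotallyGeodesic 3 f) :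
    Casorati.IsRigid 3 f :=
  Casorati.isRigid_of_isCasoratiIdeal hf hideal hnontrivial
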